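/- Let $r\ge 1$ and let $\mu$ be a Borel probability measure on $\mathbb R^r$ with one-dimensional marginals $\mu_1,\dots,\mu_r$. Call the coordinate $i$ \emph{lattice} if $\operatorname{supp}(\mu_i)\subset\kappa\mathbb Z$ for some $\kappa>0$; assume that then (after normalisation) $\operatorname{supp}(\mu_i)\subset\mathbb Z$ and $\gcd\operatorname{supp}(\mu_i)=1$. Suppose that $\mu$ is \emph{fully symmetric}, that is, invariant under each of the sign changes $x_i\mapsto -x_i$, $i=1,\dots,r$. The state space $\mathcal X$ is the set of all $x\in[0,\infty)^r$ such that $x_i\in\mathbb N_0$ for each lattice coordinate $i$. Let $Y_1,Y_2,\dots$ be i.i.d. random vectors with law $\mu$. The reflected random walk induced by $\mu$ and starting at $x\in\mathcal X$ is $X_0^x=x$, $X_n^x=|X_{n-1}^x-Y_n|$, with the absolute value taken coordinatewise. Let $\pi(x)$ be the vector of the parities of the lattice coordinates of $x$, and let $\Gamma$ be the subgroup generated by all $\varepsilon$ with $\Pr[\pi(Y_1)=\varepsilon]>0$ in the additive group of vectors mod $2$ indexed by the lattice coordinates. The state space is the disjoint union of the classes $\mathcal X^{(j)}=\{x\in\mathcal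 X:\pi(x)\in\Gamma^{(j)}\}$, where $\Gamma^{(j)}$ runs through the cosets of $\Gamma$ (a single class if there is no lattice coordinate). (1) If $r\ge 3$, then the reflected random walk is transient: for every $x\in\mathcal X$, $\Pr[\|X_n^x-x\|\to\infty]=1$. (2) If $r\in\{1,2\}$ and $\int\|y\|^r\,d\mu(y)<\infty$, then the reflected random walk is (topologically) recurrent on each of the classes $\mathcal X^{(j)}$, with attractor $\mathcal X^{(j)}$. That is, $\mathcal X^{(j)}$ is closed, it is the largest non-empty closed subset $L$ of $\mathcal X^{(j)}$ with the following property, and in particular it has this property itself: for every open set $U$ that intersects $L$ and every starting point $x\in\mathcal X^{(j)}$, $\Pr[X_n^x\in U\text{ infinitely often}]=1$. -/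

import Mathlib

open MeasureTheory ProbabilityTheory Filter Topology

namespace ReflectedRW

/-- Coordinatewise absolute value on Euclidean space. -/
noncomputable def coordAbs {r : ℕ} (x : EuclideanSpace ℝ (Fin r)) : EuclideanSpace ℝ (Fin r) :=
  WithLp.toLp 2 (fun i => |x i|)

/-- The reflected random walk: `X₀ = x`, `Xₙ₊₁ = |Xₙ - Yₙ|`, where `Y n` is the
`(n + 1)`-st increment. -/
noncomputable def rrw {r : ℕ} {Ω : Type*} (Y : ℕ → Ω → EuclideanSpace ℝ (Fin r))
    (x : EuclideanSpace ℝ (Fin r)) : ℕ → Ω → EuclideanSpace ℝ (Fin r)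
  | 0, _ => x
  | n + 1, ω => coordAbs (rrw Y x n ω - Y n ω)

/-- The sign change of the `i`-th coordinate. -/
noncomputable def flipCoord {r : ℕ} (i : Fin r) (y : EuclideanSpace ℝ (Fin r)) :
    EuclideanSpace ℝ (Fin r) :=
  WithLp.toLp 2 (fun j => if j = i then -(y j) else y j)

/-- `μ` is invariant under all coordinate sign changes. -/
def FullySymmetric {r : ℕ} (μ : Measure (EuclideanSpace ℝ (Fin r))) : Prop :=
  ∀ i, μ.map (flipCoord i) = μ

/-- The `i`-th one-dimensional marginal of `μ`. -/
noncomputable def marginal {r : ℕ} (μ : Measure (EuclideanSpace ℝ (Fin r))) (i : Fin r) :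
    Measure ℝ :=
  μ.map (fun y => y i)

/-- The support of `ν` lies in `κ ℤ` for some `κ > 0`. -/
def IsLattice (ν : Measure ℝ) : Prop :=
  ∃ κ : ℝ, 0 < κ ∧ ∀ y ∈ ν.support, ∃ k : ℤ, y = κ * k

/-- The support of `ν` consists of integers whose greatest common divisor is `1`. -/
def IsNormalizedLattice (ν : Measure ℝ) : Prop :=
  (∀ y ∈ ν.support, ∃ k : ℤ, y = k) ∧
    ∀ d : ℕ, (∀ k : ℤ, (k : ℝ) ∈ ν.support → (d : ℤ) ∣ k) → d = 1

/-- The state space: points with non-negative coordinates that are integers in the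
lattice coordinates. -/
def stateSpace {r : ℕ} (μ : Measure (EuclideanSpace ℝ (Fin r))) :
    Set (EuclideanSpace ℝ (Fin r)) :=
  {x | ∀ i, 0 ≤ x i ∧ (IsLattice (marginal μ i) → ∃ k : ℕ, x i = k)}

open Classical in
/-- The vector of the parities of the lattice coordinates of `x` (which are integers at all
points where this is used); the entries of the non-lattice coordinates are set to `0`. -/
noncomputable def parity {r : ℕ} (μ : Measure (EuclideanSpace ℝ (Fin r)))
    (x : EuclideanSpace ℝ (Fin r)) : Fin r → ZMod 2 :=
  fun i => if IsLattice (marginal μ i) then ((⌊x i⌋ : ℤ) : ZMod 2) else 0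

/-- The subgroup of the hypercube formed by the elements that the random walk of the parities
can reach from `0`. -/
noncomputable def parityGroup {r : ℕ} (μ : Measure (EuclideanSpace ℝ (Fin r))) :
    AddSubgroup (Fin r → ZMod 2) :=
  AddSubgroup.closure {ε | 0 < μ {y | parity μ y = ε}}

/-- The class of `x₀` in the decomposition of the state space according to the cosets of the
parity group. -/
def parityClass {r : ℕ} (μ : Measure (EuclideanSpace ℝ (Fin r)))
    (x₀ : EuclideanSpace ℝ (Fin r)) : Set (EuclideanSpace ℝ (Fin r)) :=
  {x | x ∈ stateSpace μ ∧ parity μ x - parity μ x₀ ∈ parityGroup μ}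

section Recurrence

variable {E Ω : Type*} [MetricSpace E] [MeasurableSpace Ω]

/-- Transience on the state space `S` of a process `X x n` (`x` the starting point, `n` the
time): from every starting point the distance to it tends to infinity almost surely. -/
def IsTransient (P : Measure Ω) (S : Set E) (X : E → ℕ → Ω → E) : Prop :=
  ∀ x ∈ S, ∀ᵐ ω ∂P, Tendsto (fun n => dist (X x n ω) x) atTop atTop

/-- `L` is a non-empty closed subset of `C`, and from every starting point in `C` every open
set that meets `L` is visited infinitely often almost surely. -/
def IsRecurrenceSet (P : Measure Ω) (C : Set E) (X : E → ℕ → Ω → E) (L : Set E) : Prop :=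
  L.Nonempty ∧ IsClosed L ∧ L ⊆ C ∧
    ∀ U : Set E, IsOpen U → (U ∩ L).Nonempty →
      ∀ x ∈ C, ∀ᵐ ω ∂P, ∃ᶠ n in atTop, X x n ω ∈ U

/-- The process is topologically recurrent on `C`, and `L` is its attractor: the maximal
recurrence set. -/
def IsRecurrentWithAttractor (P : Measure Ω) (C : Set E) (X : E → ℕ → Ω → E) (L : Set E) :
    Prop :=
  IsRecurrenceSet P C X L ∧ ∀ L', IsRecurrenceSet P C X L' → L' ⊆ L

end Recurrence

end ReflectedRW

/-! Unfold the reflection. Instead of reflecting the position, flip the signs of the coordinates of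
`Y n` according to the signs of the current unreflected position. Full symmetry makes the twisted
increments i.i.d. with law `μ` again (`FullySymmetric.map_unfoldInc`), so the reflected walk is,
path by path, the coordinatewise absolute value of `x - S n` with `S` an ordinary random walk
(`FullySymmetric.ae_rrw`).

For `r ≥ 3`, no moments are needed. The truncated covariance matrix is diagonal by symmetry and
nondegenerate, hence `‖charFun μ t‖ ≤ exp (-c ‖t‖²)` near `0`. Smoothing turns this into `P(‖S n‖ ≤
R) = O(n ^ (-r/2))`, which is summable, and Borel–Cantelli gives transience.

For `r ≤ 2`, the law of large numbers (`r = 1`) or Chebyshev (`r = 2`) puts `S n` in a box made of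
`O(n)` cells with probability at least `1/2`. By symmetry `S (2n)` is a difference of two
independent copies of `S n`, so by Cauchy–Schwarz it is near `0` with probability at least `c / n`.
The Green function diverges, and `0` is a recurrent point.

The translations preserving the recurrent points form a closed group containing `μ.support`. It
contains both `y` and its flip in coordinate `i`, hence `2 * y i` along axis `i`; gcd `1`, or the
failure of the lattice property, then puts every vector of parity `0` in the group, and support
points realise the generators of `parityGroup μ` (`mem_recurrenceGroup_of_parity_mem`). So `x - x'`
is recurrent for any two points of a class. -/

namespace ReflectedRW

/-! ### I.i.d. sequences: cylinders, and splitting off the first term. -/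

section IID

variable {E : Type*} [MeasurableSpace E]

/-- The law of an i.i.d. sequence with common law `μ`. -/
noncomputable abbrev iid (μ : Measure E) : Measure (ℕ → E) :=
  Measure.infinitePi (fun _ : ℕ => μ)

/-- Padding with `Set.univ` turns any finite index set into an initial segment; on initial segments
one can argue by induction on the length. -/
lemma eq_iid_of_cylinders {μ : Measure E} [IsProbabilityMeasure μ] {ν : Measure (ℕ → E)}
    (h : ∀ (N : ℕ) (t : ℕ → Set E), (∀ n, MeasurableSet (t n)) →
      ν {z | ∀ k < N, z k ∈ t k} = ∏ k ∈ Finset.range N, μ (t k)) : ν = iid μ := by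
  classical
  refine Measure.eq_infinitePi _ fun s t ht => ?_
  have key := h (s.sup id + 1) (fun k => if k ∈ s then t k else Set.univ) (fun n => by
    split_ifs <;> simp [ht])
  have hs : ∀ k ∈ s, k < s.sup id + 1 := fun k hk => Nat.lt_succ_of_le (Finset.le_sup (f := id) hk)
  have e1 : {z : ℕ → E | ∀ k < s.sup id + 1, z k ∈ if k ∈ s then t k else Set.univ}
      = Set.pi s t := by
    ext z
    simp only [Set.mem_ofPred_eq, Set.mem_pi, Finset.mem_coe]
    refine ⟨fun hz k hk => by simpa [hk] using hz k (hs k hk), fun hz k _ => ?_⟩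
    split_ifs with hk
    · exact hz k hk
    · trivial
  rw [e1] at key
  rw [key, ← Finset.prod_subset (s₁ := s) (fun k hk => Finset.mem_range.2 (hs k hk))]
  · exact Finset.prod_congr rfl fun k hk => by simp [hk]
  · intro k _ hk
    simp [hk]

lemma measurePreserving_head_tail (μ : Measure E) [IsProbabilityMeasure μ] :
    MeasurePreserving (fun z : ℕ → E => (z 0, fun n => z (n + 1))) (iid μ) (μ.prod (iid μ)) := by
  let c : E × (ℕ → E) → ℕ → E := fun p n => Nat.casesOn n p.1 p.2
  have hc : Measurable c := by
    refine measurable_pi_lambda _ fun n => ?_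
    cases n with
    | zero => exact measurable_fst
    | succ n => exact (measurable_pi_apply n).comp measurable_snd
  have hcyl (N : ℕ) (t : ℕ → Set E) (ht : ∀ n, MeasurableSet (t n)) :
      iid μ {z | ∀ k < N, z k ∈ t k} = ∏ k ∈ Finset.range N, μ (t k) := by
    rw [← Measure.infinitePi_pi (fun _ : ℕ => μ) (fun i _ => ht i)]
    congr 1
    ext z
    simp
  have hcons : (μ.prod (iid μ)).map c = iid μ := by
    refine eq_iid_of_cylinders fun N t ht => ?_
    have hm : MeasurableSet {z : ℕ → E | ∀ k < N, z k ∈ t k} := by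
      simp only [Set.ofPred_forall]
      exact .iInter fun k => .iInter fun _ => measurable_pi_apply k (ht k)
    rw [Measure.map_apply hc hm]
    cases N with
    | zero => simp
    | succ N =>
      have : c ⁻¹' {z : ℕ → E | ∀ k < N + 1, z k ∈ t k}
          = t 0 ×ˢ {z : ℕ → E | ∀ k < N, z k ∈ t (k + 1)} := by
        ext p
        simp only [Set.mem_preimage, Set.mem_ofPred_eq, Set.mem_prod]
        constructor
        · exact fun h => ⟨h 0 (by omega), fun k hk => h (k + 1) (by omega)⟩
        · rintro ⟨h0, h1⟩ (_ | k) hk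
          · exact h0
          · exact h1 k (by omega)
      rw [this, Measure.prod_prod, hcyl N (fun k => t (k + 1)) (fun k => ht _),
        Finset.prod_range_succ', mul_comm]
  refine ⟨by fun_prop, ?_⟩
  conv_lhs => rw [← hcons]
  rw [Measure.map_map (by fun_prop) hc]
  exact Measure.map_id

lemma iIndepFun_eval_iid (μ : Measure E) [IsProbabilityMeasure μ] :
    iIndepFun (fun (i : ℕ) (z : ℕ → E) => z i) (iid μ) :=
  iIndepFun_infinitePi (P := fun _ : ℕ => μ) (X := fun _ x => x) fun _ => measurable_id

end IID

/-! ### Random walks and their Markov property at a fixed time. -/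

section PartialSum

variable {E : Type*} [AddCommGroup E]

/-- The random walk with increments `z`, started at the origin. -/
def partialSum (n : ℕ) (z : ℕ → E) : E := ∑ k ∈ Finset.range n, z k

lemma partialSum_add (n m : ℕ) (z : ℕ → E) :
    partialSum (n + m) z = partialSum n z + partialSum m (fun k => z (n + k)) :=
  Finset.sum_range_add _ _ _

variable [MeasurableSpace E] [MeasurableAdd₂ E]

@[fun_prop]
lemma measurable_partialSum (n : ℕ) : Measurable (partialSum n : (ℕ → E) → E) := by
  unfold partialSum
  fun_prop

lemma measurePreserving_partialSum_shift (μ : Measure E) [IsProbabilityMeasure μ] (n : ℕ) :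
    MeasurePreserving (fun z : ℕ → E => (partialSum n z, fun k => z (n + k))) (iid μ)
      (((iid μ).map (partialSum n)).prod (iid μ)) := by
  -- Leaving the law of the position unspecified lets the induction convolve it with `μ` at each
  -- step; it is identified at the end as the first marginal.
  suffices h : ∃ ν : Measure E, SFinite ν ∧ MeasurePreserving
      (fun z : ℕ → E => (partialSum n z, fun k => z (n + k))) (iid μ) (ν.prod (iid μ)) by
    obtain ⟨ν, hν, hp⟩ := h
    have : (iid μ).map (partialSum n) = ν := by
      have := (measurePreserving_fst (μ := ν) (ν := iid μ)).comp hp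
      exact this.map_eq
    rwa [this]
  induction n with
  | zero =>
    refine ⟨Measure.dirac 0, inferInstance, by fun_prop, ?_⟩
    rw [Measure.dirac_prod]
    simp [partialSum]
  | succ n ih =>
    obtain ⟨ν, hν, hp⟩ := ih
    refine ⟨(ν.prod μ).map (fun p => p.1 + p.2), inferInstance, ?_⟩
    have h1 := (MeasurePreserving.id ν).prod (measurePreserving_head_tail μ)
    have h2 := (measurePreserving_prodAssoc ν μ (iid μ)).symm
    have h3 : MeasurePreserving (fun p : E × E => p.1 + p.2) (ν.prod μ)
        ((ν.prod μ).map (fun p => p.1 + p.2)) := ⟨by fun_prop, rfl⟩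
    have h4 := ((h3.prod (MeasurePreserving.id (iid μ))).comp (h2.comp h1)).comp hp
    convert h4 using 1
    ext z : 1
    simp only [Function.comp, Prod.map, id]
    refine Prod.ext ?_ ?_
    · simp [partialSum, Finset.sum_range_succ, MeasurableEquiv.prodAssoc, Equiv.prodAssoc]
    · funext k
      simp [MeasurableEquiv.prodAssoc, Equiv.prodAssoc, add_comm, add_left_comm]

/-- Independence of the position at time `n` and the increments after time `n`. -/
lemma iid_partialSum_shift (μ : Measure E) [IsProbabilityMeasure μ] (n : ℕ) {A : Set E}
    {B : Set (ℕ → E)} (hA : MeasurableSet A) (hB : MeasurableSet B) :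
    iid μ {z | partialSum n z ∈ A ∧ (fun k => z (n + k)) ∈ B}
      = iid μ {z | partialSum n z ∈ A} * iid μ B := by
  have h := (measurePreserving_partialSum_shift μ n).measure_preimage
    (hA.prod hB).nullMeasurableSet
  rw [Measure.prod_prod, Measure.map_apply (measurable_partialSum n) hA] at h
  exact h

end PartialSum

/-! ### Unfolding the reflected walk into a walk with independent increments. -/

section Unfolding

variable {r : ℕ}

/-- Flip the signs of those coordinates of `y` for which the coordinate of `s` is negative. -/
noncomputable def signTwist (s y : EuclideanSpace ℝ (Fin r)) : EuclideanSpace ℝ (Fin r) :=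
  WithLp.toLp 2 (fun i => if 0 ≤ s i then y i else -(y i))

/-- The random walk whose coordinatewise absolute value is the reflected random walk. -/
noncomputable def unfoldPos (x : EuclideanSpace ℝ (Fin r)) (y : ℕ → EuclideanSpace ℝ (Fin r)) :
    ℕ → EuclideanSpace ℝ (Fin r)
  | 0 => x
  | n + 1 => unfoldPos x y n - signTwist (unfoldPos x y n) (y n)

/-- The increments of the unfolded random walk. -/
noncomputable def unfoldInc (x : EuclideanSpace ℝ (Fin r)) (y : ℕ → EuclideanSpace ℝ (Fin r))
    (n : ℕ) : EuclideanSpace ℝ (Fin r) :=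
  signTwist (unfoldPos x y n) (y n)

lemma unfoldPos_eq (x : EuclideanSpace ℝ (Fin r)) (y : ℕ → EuclideanSpace ℝ (Fin r)) (n : ℕ) :
    unfoldPos x y n = x - partialSum n (unfoldInc x y) := by
  induction n with
  | zero => simp [unfoldPos, partialSum]
  | succ n ih =>
    rw [partialSum, Finset.sum_range_succ, ← partialSum, ← sub_sub, ← ih]
    rfl

lemma rrw_eq_coordAbs_unfoldPos {Ω : Type*} (Y : ℕ → Ω → EuclideanSpace ℝ (Fin r))
    (x : EuclideanSpace ℝ (Fin r)) (hx : ∀ i, 0 ≤ x i) (n : ℕ) (ω : Ω) :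
    rrw Y x n ω = coordAbs (unfoldPos x (fun k => Y k ω) n) := by
  induction n with
  | zero =>
    ext i
    simp [rrw, coordAbs, unfoldPos, abs_of_nonneg (hx i)]
  | succ n ih =>
    ext i
    simp only [rrw, ih, coordAbs, unfoldPos, signTwist, PiLp.sub_apply]
    split_ifs with h
    · rw [abs_of_nonneg h]
    · rw [abs_of_neg (not_le.1 h), ← abs_neg]
      congr 1
      ring

lemma unfoldPos_succ (x : EuclideanSpace ℝ (Fin r)) (y : ℕ → EuclideanSpace ℝ (Fin r)) (n : ℕ) :
    unfoldPos x y (n + 1) = unfoldPos (x - signTwist x (y 0)) (fun k => y (k + 1)) n := by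
  induction n with
  | zero => rfl
  | succ n ih =>
    rw [unfoldPos, ih]
    rfl

lemma unfoldInc_succ (x : EuclideanSpace ℝ (Fin r)) (y : ℕ → EuclideanSpace ℝ (Fin r)) (n : ℕ) :
    unfoldInc x y (n + 1) = unfoldInc (x - signTwist x (y 0)) (fun k => y (k + 1)) n := by
  rw [unfoldInc, unfoldPos_succ, unfoldInc]

lemma measurable_signTwist :
    Measurable (fun p : EuclideanSpace ℝ (Fin r) × EuclideanSpace ℝ (Fin r) =>
      signTwist p.1 p.2) := by
  unfold signTwist
  refine (WithLp.measurable_toLp 2 _).comp (measurable_pi_lambda _ fun i => ?_)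
  refine Measurable.ite (measurableSet_le measurable_const (by fun_prop)) (by fun_prop)
    (by fun_prop)

lemma measurable_unfoldPos (n : ℕ) :
    Measurable (fun p : EuclideanSpace ℝ (Fin r) × (ℕ → EuclideanSpace ℝ (Fin r)) =>
      unfoldPos p.1 p.2 n) := by
  induction n with
  | zero => exact measurable_fst
  | succ n ih =>
    exact ih.sub (measurable_signTwist.comp
      (ih.prodMk ((measurable_pi_apply n).comp measurable_snd)))

lemma measurable_unfoldInc (n : ℕ) :
    Measurable (fun p : EuclideanSpace ℝ (Fin r) × (ℕ → EuclideanSpace ℝ (Fin r)) =>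
      unfoldInc p.1 p.2 n) :=
  measurable_signTwist.comp
    ((measurable_unfoldPos n).prodMk ((measurable_pi_apply n).comp measurable_snd))

lemma measurable_flipCoord (i : Fin r) : Measurable (flipCoord i) := by
  unfold flipCoord
  refine (WithLp.measurable_toLp 2 _).comp (measurable_pi_lambda _ fun j => ?_)
  split_ifs <;> fun_prop

lemma FullySymmetric.map_flip_finset {μ : Measure (EuclideanSpace ℝ (Fin r))}
    (h : FullySymmetric μ) (A : Finset (Fin r)) :
    μ.map (fun y => WithLp.toLp 2 (fun j => if j ∈ A then -(y j) else y j)) = μ := by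
  induction A using Finset.induction_on with
  | empty =>
    simp only [Finset.notMem_empty, if_false]
    exact Measure.map_id
  | insert i A hi ih =>
    have hm : Measurable (fun y : EuclideanSpace ℝ (Fin r) =>
        (WithLp.toLp 2 (fun j => if j ∈ A then -(y j) else y j) : EuclideanSpace ℝ (Fin r))) := by
      refine (WithLp.measurable_toLp 2 _).comp (measurable_pi_lambda _ fun j => ?_)
      split_ifs <;> fun_prop
    conv_rhs => rw [← ih, ← h i, Measure.map_map hm (measurable_flipCoord i)]
    congr 1
    ext y j
    by_cases hj : j = i
    · subst hj
      simp [flipCoord, hi]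
    · simp [flipCoord, hj]

lemma FullySymmetric.map_signTwist {μ : Measure (EuclideanSpace ℝ (Fin r))}
    (h : FullySymmetric μ) (s : EuclideanSpace ℝ (Fin r)) : μ.map (signTwist s) = μ := by
  classical
  convert h.map_flip_finset (Finset.univ.filter fun i => s i < 0) using 2
  ext y j
  by_cases hj : 0 ≤ s j
  · simp [signTwist, hj, not_lt.2 hj]
  · simp [signTwist, hj, not_le.1 hj]

lemma FullySymmetric.map_neg {μ : Measure (EuclideanSpace ℝ (Fin r))}
    (h : FullySymmetric μ) : μ.map (fun y => -y) = μ := by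
  classical
  convert h.map_flip_finset Finset.univ using 2
  ext y j
  simp

/-- The twist at each time is determined by the past, and every fixed twist preserves `μ`. Hence,
conditionally on the past, the twisted increment still has law `μ`. -/
lemma FullySymmetric.map_unfoldInc {μ : Measure (EuclideanSpace ℝ (Fin r))}
    [IsProbabilityMeasure μ] (h : FullySymmetric μ) (x : EuclideanSpace ℝ (Fin r)) :
    (iid μ).map (unfoldInc x) = iid μ := by
  have hm1 (x : EuclideanSpace ℝ (Fin r)) : Measurable (unfoldInc x) :=
    measurable_pi_lambda _ fun n => (measurable_unfoldInc n).comp measurable_prodMk_left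
  refine eq_iid_of_cylinders fun N t ht => ?_
  have hm2 (N : ℕ) (t : ℕ → Set (EuclideanSpace ℝ (Fin r))) (ht : ∀ n, MeasurableSet (t n)) :
      MeasurableSet {p : EuclideanSpace ℝ (Fin r) × (ℕ → EuclideanSpace ℝ (Fin r)) |
        ∀ k < N, unfoldInc p.1 p.2 k ∈ t k} := by
    simp only [Set.ofPred_forall]
    exact .iInter fun k => .iInter fun _ => measurable_unfoldInc k (ht k)
  have hm3 : MeasurableSet {z : ℕ → EuclideanSpace ℝ (Fin r) | ∀ k < N, z k ∈ t k} := by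
    simp only [Set.ofPred_forall]
    exact .iInter fun k => .iInter fun _ => measurable_pi_apply k (ht k)
  rw [Measure.map_apply (hm1 x) hm3]
  clear hm3
  change iid μ {y | ∀ k < N, unfoldInc x y k ∈ t k} = _
  -- After one step the unfolding restarts from a random point; the induction hypothesis gives a
  -- probability that does not depend on that point, so the first factor splits off.
  induction N generalizing x t with
  | zero => simp
  | succ N ih =>
    have hT : Measurable (signTwist x) := measurable_signTwist.comp measurable_prodMk_left
    set B : Set (EuclideanSpace ℝ (Fin r) × (ℕ → EuclideanSpace ℝ (Fin r))) :=
      {p | signTwist x p.1 ∈ t 0 ∧ ∀ k < N, unfoldInc (x - signTwist x p.1) p.2 k ∈ t (k + 1)}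
      with hB
    have hBm : MeasurableSet B := by
      refine (hT.comp measurable_fst (ht 0)).inter ?_
      exact ((measurable_const.sub (hT.comp measurable_fst)).prodMk measurable_snd)
        (hm2 N (fun k => t (k + 1)) fun k => ht _)
    have e1 : {y | ∀ k < N + 1, unfoldInc x y k ∈ t k}
        = (fun z : ℕ → EuclideanSpace ℝ (Fin r) => (z 0, fun n => z (n + 1))) ⁻¹' B := by
      ext y
      simp only [hB, Set.mem_preimage, Set.mem_ofPred_eq]
      constructor
      · exact fun h => ⟨h 0 (by omega), fun k hk => by
          rw [← unfoldInc_succ]; exact h (k + 1) (by omega)⟩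
      · rintro ⟨h0, h1⟩ (_ | k) hk
        · exact h0
        · rw [unfoldInc_succ]; exact h1 k (by omega)
    rw [e1, (measurePreserving_head_tail μ).measure_preimage hBm.nullMeasurableSet,
      Measure.prod_apply hBm]
    have e2 (a : EuclideanSpace ℝ (Fin r)) : iid μ (Prod.mk a ⁻¹' B)
        = (signTwist x ⁻¹' t 0).indicator (fun _ => ∏ k ∈ Finset.range N, μ (t (k + 1))) a := by
      by_cases ha : signTwist x a ∈ t 0
      · rw [Set.indicator_of_mem (by exact ha), ← ih (x - signTwist x a) (fun k => t (k + 1))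
          (fun k => ht _)]
        congr 1
        ext y
        simp [hB, ha]
      · rw [Set.indicator_of_notMem (by exact ha)]
        simp [hB, ha]
    simp_rw [e2]
    rw [lintegral_indicator (hT (ht 0)), setLIntegral_const, ← Measure.map_apply hT (ht 0),
      h.map_signTwist, Finset.prod_range_succ']

/-- Almost sure statements about a reflected random walk follow from almost sure statements about
the random walk with independent increments of law `μ`. -/
lemma FullySymmetric.ae_rrw {μ : Measure (EuclideanSpace ℝ (Fin r))}
    [IsProbabilityMeasure μ] (h : FullySymmetric μ) {Ω : Type*} [MeasurableSpace Ω]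
    {P : Measure Ω} {Y : ℕ → Ω → EuclideanSpace ℝ (Fin r)}
    (hlaw : ∀ n, HasLaw (Y n) μ P) (hindep : iIndepFun Y P)
    {x : EuclideanSpace ℝ (Fin r)} (hx : ∀ i, 0 ≤ x i)
    {Q : (ℕ → EuclideanSpace ℝ (Fin r)) → Prop}
    (hQ : ∀ᵐ z ∂(iid μ), Q (fun n => coordAbs (x - partialSum n z))) :
    ∀ᵐ ω ∂P, Q (fun n => rrw Y x n ω) := by
  have hY := hindep.hasLaw_infinitePi hlaw (aemeasurable_pi_lambda _ fun n => (hlaw n).aemeasurable)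
  have hm1 : Measurable (unfoldInc x) :=
    measurable_pi_lambda _ fun n => (measurable_unfoldInc n).comp measurable_prodMk_left
  have h1 : ∀ᵐ y ∂(iid μ), Q (fun n => coordAbs (unfoldPos x y n)) := by
    rw [← h.map_unfoldInc x] at hQ
    simp only [unfoldPos_eq]
    exact ae_of_ae_map hm1.aemeasurable hQ
  have h2 := h1
  rw [iid, ← hY.map_eq] at h2
  have h3 := ae_of_ae_map hY.aemeasurable h2
  simpa only [← rrw_eq_coordAbs_unfoldPos Y x hx] using h3

end Unfolding

/-! ### Transience for `r ≥ 3` by characteristic functions. -/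

section Transience

variable {r : ℕ}

lemma marginal_support_subset_of_ae_zero {μ : Measure (EuclideanSpace ℝ (Fin r))} {i : Fin r}
    (h : ∀ᵐ y ∂μ, y i = 0) : (marginal μ i).support ⊆ {0} := by
  refine Measure.support_subset_of_isClosed isClosed_singleton ?_
  rw [marginal, mem_ae_map_iff (by fun_prop) (measurableSet_singleton 0)]
  exact h

/-- Normalised lattice marginals and non-lattice marginals are not concentrated at `0`. -/
lemma measure_coord_ne_zero_pos {μ : Measure (EuclideanSpace ℝ (Fin r))}
    (hlat : ∀ i, IsLattice (marginal μ i) → IsNormalizedLattice (marginal μ i)) (i : Fin r) :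
    0 < μ {y | y i ≠ 0} := by
  rw [pos_iff_ne_zero]
  intro h
  have hs := marginal_support_subset_of_ae_zero (μ := μ) (i := i) h
  have hl : IsLattice (marginal μ i) := ⟨1, one_pos, fun y hy => ⟨0, by simpa using hs hy⟩⟩
  -- For a marginal concentrated at `0`, the number `d = 0` divides the whole support, which
  -- contradicts gcd `1`.
  have := (hlat i hl).2 0 fun k hk => by
    have hk0 : k = 0 := Int.cast_eq_zero.1 (Set.mem_singleton_iff.1 (hs hk))
    simp [hk0]
  exact zero_ne_one this

/-- Flipping coordinate `i` preserves the ball and changes the sign of the integrand. The truncation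
replaces a second moment assumption. -/
lemma FullySymmetric.setIntegral_mul_eq_zero {μ : Measure (EuclideanSpace ℝ (Fin r))}
    (h : FullySymmetric μ) {i j : Fin r} (hij : i ≠ j) (M : ℝ) :
    ∫ y in Metric.closedBall (0 : EuclideanSpace ℝ (Fin r)) M, y i * y j ∂μ = 0 := by
  have hn (y : EuclideanSpace ℝ (Fin r)) : ‖flipCoord i y‖ = ‖y‖ := by
    simp only [EuclideanSpace.norm_eq, flipCoord]
    congr 1
    refine Finset.sum_congr rfl fun k _ => ?_
    split_ifs <;> simp
  have hp : flipCoord i ⁻¹' (Metric.closedBall (0 : EuclideanSpace ℝ (Fin r)) M)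
      = Metric.closedBall 0 M := by
    ext y
    simp [hn]
  have h1 : ∫ y in Metric.closedBall (0 : EuclideanSpace ℝ (Fin r)) M, y i * y j ∂μ
      = ∫ y in Metric.closedBall (0 : EuclideanSpace ℝ (Fin r)) M, -(y i * y j) ∂μ := by
    conv_lhs => rw [← h i]
    rw [setIntegral_map Metric.isClosed_closedBall.measurableSet
      (by fun_prop) (measurable_flipCoord i).aemeasurable, hp]
    congr 1
    ext y
    simp [flipCoord, hij.symm]
  rw [integral_neg] at h1
  linarith

/-- On a large ball `B` the second moment form is diagonal with positive entries, so it dominates `a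
* ‖t‖ ^ 2`; the bound `cos u ≤ 1 - (2 / π²) u²` transfers this to the cosine integral, and the part
outside `B` only helps. -/
lemma exists_one_sub_integral_cos_ge {μ : Measure (EuclideanSpace ℝ (Fin r))}
    [IsProbabilityMeasure μ] (h : FullySymmetric μ) (hpos : ∀ i, 0 < μ {y | y i ≠ 0}) :
    ∃ c > 0, ∃ δ > 0, ∀ t : EuclideanSpace ℝ (Fin r), ‖t‖ ≤ δ →
      ∫ y, Real.cos (inner ℝ y t) ∂μ ≤ 1 - c * ‖t‖ ^ 2 := by
  have hM (i : Fin r) : ∃ M : ℕ, 0 < μ ({y | y i ≠ 0} ∩ Metric.closedBall 0 M) := by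
    by_contra! hcon
    have : μ (⋃ M : ℕ, {y : EuclideanSpace ℝ (Fin r) | y i ≠ 0} ∩ Metric.closedBall 0 M) = 0 :=
      measure_iUnion_null fun M => le_antisymm (hcon M) bot_le
    rw [← Set.inter_iUnion, Metric.iUnion_closedBall_nat, Set.inter_univ] at this
    exact (hpos i).ne' this
  choose M hM using hM
  set N : ℕ := Finset.univ.sup M
  set B : Set (EuclideanSpace ℝ (Fin r)) := Metric.closedBall 0 (N : ℝ) with hB
  have hBm : MeasurableSet B := Metric.isClosed_closedBall.measurableSet
  have hbd (i : Fin r) {y : EuclideanSpace ℝ (Fin r)} (hy : y ∈ B) : ‖y i‖ ≤ N :=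
    (PiLp.norm_apply_le y i).trans (by simpa [hB] using hy)
  have hint (i j : Fin r) : IntegrableOn (fun y : EuclideanSpace ℝ (Fin r) => y i * y j) B μ := by
    refine Measure.integrableOn_of_bounded (M := (N : ℝ) * N) (measure_ne_top _ _) (by fun_prop) ?_
    filter_upwards [ae_restrict_mem hBm] with y hy
    rw [norm_mul]
    exact mul_le_mul (hbd i hy) (hbd j hy) (norm_nonneg _) (by positivity)
  have ha (i : Fin r) : 0 < ∫ y in B, y i * y i ∂μ := by
    rw [setIntegral_pos_iff_support_of_nonneg_ae
      (Eventually.of_forall fun y => mul_self_nonneg _) (hint i i)]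
    refine (hM i).trans_le (measure_mono fun y hy => ⟨?_, ?_⟩)
    · simpa using hy.1
    · exact Metric.closedBall_subset_closedBall
        (by exact_mod_cast Finset.le_sup (f := M) (Finset.mem_univ i)) hy.2
  obtain ⟨a, ha0, hai⟩ : ∃ a > 0, ∀ i, a ≤ ∫ y in B, y i * y i ∂μ := by
    rcases isEmpty_or_nonempty (Fin r) with hr | hr
    · exact ⟨1, one_pos, fun i => hr.elim i⟩
    · obtain ⟨i, hi⟩ := Finite.exists_min fun i => ∫ y in B, y i * y i ∂μ
      exact ⟨_, ha i, hi⟩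
  have hq (t : EuclideanSpace ℝ (Fin r)) :
      a * ‖t‖ ^ 2 ≤ ∫ y in B, (inner ℝ y t) ^ 2 ∂μ := by
    have e1 (y : EuclideanSpace ℝ (Fin r)) :
        (inner ℝ y t) ^ 2 = ∑ i, ∑ j, (t i * t j) * (y i * y j) := by
      rw [sq, PiLp.inner_apply, Finset.sum_mul_sum]
      refine Finset.sum_congr rfl fun i _ => Finset.sum_congr rfl fun j _ => ?_
      simp only [RCLike.inner_apply, conj_trivial]
      ring
    simp_rw [e1]
    rw [integral_finsetSum _ fun i _ => integrable_finsetSum _ fun j _ => (hint i j).const_mul _,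
      EuclideanSpace.real_norm_sq_eq, Finset.mul_sum]
    refine Finset.sum_le_sum fun i _ => ?_
    rw [integral_finsetSum _ fun j _ => (hint i j).const_mul _, Finset.sum_eq_single i]
    · rw [integral_const_mul]
      nlinarith [hai i, sq_nonneg (t i)]
    · intro j _ hj
      rw [integral_const_mul, h.setIntegral_mul_eq_zero hj.symm, mul_zero]
    · simp
  have hcosint (t : EuclideanSpace ℝ (Fin r)) :
      Integrable (fun y : EuclideanSpace ℝ (Fin r) => 1 - Real.cos (inner ℝ y t)) μ := by
    refine Integrable.of_bound (by fun_prop) 2 (Eventually.of_forall fun y => ?_)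
    rw [Real.norm_eq_abs, abs_le]
    constructor <;> linarith [Real.cos_le_one (inner ℝ y t), Real.neg_one_le_cos (inner ℝ y t)]
  -- The radius `1 / (N + 1)` keeps `|inner ℝ y t| ≤ 1 ≤ π` for `y ∈ B`.
  refine ⟨2 / Real.pi ^ 2 * a, by positivity, 1 / (N + 1), by positivity, fun t ht => ?_⟩
  have h1 : ∫ y in B, 2 / Real.pi ^ 2 * (inner ℝ y t) ^ 2 ∂μ
      ≤ ∫ y in B, (1 - Real.cos (inner ℝ y t)) ∂μ := by
    have hle : ∀ y ∈ B, |inner ℝ y t| ≤ 1 := fun y hy => by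
      refine (abs_real_inner_le_norm y t).trans ?_
      have hy' : ‖y‖ ≤ N := by simpa [hB] using hy
      calc ‖y‖ * ‖t‖ ≤ N * (1 / (N + 1)) := by gcongr
        _ ≤ 1 := by rw [mul_one_div, div_le_one (by positivity)]; linarith
    refine setIntegral_mono_on ?_ (hcosint t).integrableOn hBm fun y hy => ?_
    · refine Measure.integrableOn_of_bounded (M := 2 / Real.pi ^ 2) (measure_ne_top _ _)
        (by fun_prop) ?_
      filter_upwards [ae_restrict_mem hBm] with y hy
      rw [norm_mul, norm_pow, Real.norm_eq_abs, Real.norm_eq_abs, abs_of_nonneg (by positivity)]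
      exact mul_le_of_le_one_right (by positivity) (pow_le_one₀ (abs_nonneg _) (hle y hy))
    · linarith [Real.cos_le_one_sub_mul_cos_sq
        ((hle y hy).trans (by linarith [Real.pi_gt_three]) : |inner ℝ y t| ≤ Real.pi)]
  have h2 : ∫ y in B, (1 - Real.cos (inner ℝ y t)) ∂μ ≤ ∫ y, (1 - Real.cos (inner ℝ y t)) ∂μ :=
    setIntegral_le_integral (hcosint t)
      (Eventually.of_forall fun y => by simpa using Real.cos_le_one (inner ℝ y t))
  have h3 : ∫ y, (1 - Real.cos (inner ℝ y t)) ∂μ = 1 - ∫ y, Real.cos (inner ℝ y t) ∂μ := by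
    rw [integral_sub (integrable_const _)]
    · simp
    · refine Integrable.of_bound (by fun_prop) 1 (Eventually.of_forall fun y => ?_)
      exact Real.abs_cos_le_one _
  rw [integral_const_mul] at h1
  have h4 : 2 / Real.pi ^ 2 * (a * ‖t‖ ^ 2) ≤ 2 / Real.pi ^ 2 * ∫ y in B, (inner ℝ y t) ^ 2 ∂μ :=
    mul_le_mul_of_nonneg_left (hq t) (by positivity)
  nlinarith

lemma re_charFun_eq_integral_cos {E : Type*} [NormedAddCommGroup E] [InnerProductSpace ℝ E]
    [MeasurableSpace E] [BorelSpace E] [SecondCountableTopology E]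
    (ν : Measure E) [IsFiniteMeasure ν] (t : E) :
    (charFun ν t).re = ∫ y, Real.cos (inner ℝ y t) ∂ν := by
  rw [charFun_apply]
  have hi : Integrable (fun y : E => Complex.exp (inner ℝ y t * Complex.I)) ν := by
    refine Integrable.of_bound (by fun_prop) 1 (Eventually.of_forall fun y => ?_)
    rw [Complex.norm_exp_ofReal_mul_I]
  have := integral_re hi
  simp only [RCLike.re_to_complex] at this
  rw [← this]
  simp only [Complex.exp_ofReal_mul_I_re]

/-- By symmetry the characteristic function is real, and by continuity it is positive near `0`;
there its norm is the cosine integral, and `1 - u ≤ exp (-u)`. -/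
lemma exists_norm_charFun_le_exp {μ : Measure (EuclideanSpace ℝ (Fin r))}
    [IsProbabilityMeasure μ] (h : FullySymmetric μ) (hpos : ∀ i, 0 < μ {y | y i ≠ 0}) :
    ∃ c > 0, ∃ δ > 0, ∀ t : EuclideanSpace ℝ (Fin r), ‖t‖ ≤ δ →
      ‖charFun μ t‖ ≤ Real.exp (-c * ‖t‖ ^ 2) := by
  obtain ⟨c, hc, δ, hδ, hcd⟩ := exists_one_sub_integral_cos_ge h hpos
  have hcont : Tendsto (fun t => (charFun μ t).re) (𝓝 0) (𝓝 1) := by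
    have : Continuous fun t => (charFun μ t).re := Complex.continuous_re.comp continuous_charFun
    simpa using this.tendsto 0
  obtain ⟨δ', hδ', hball⟩ := Metric.eventually_nhds_iff_ball.1 (hcont.eventually_const_lt one_pos)
  refine ⟨c, hc, min δ (δ' / 2), by positivity, fun t ht => ?_⟩
  have him : (charFun μ t).im = 0 := by
    have h1 : charFun μ (-t) = charFun μ t := by
      conv_rhs => rw [← h.map_neg]
      rw [charFun_apply, charFun_apply, integral_map (by fun_prop) (by fun_prop)]
      simp
    rw [charFun_neg] at h1
    exact Complex.conj_eq_iff_im.1 h1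
  have hre : 0 < (charFun μ t).re :=
    hball t (by rw [mem_ball_zero_iff]; linarith [min_le_right δ (δ' / 2)])
  have e : charFun μ t = ((charFun μ t).re : ℂ) := Complex.ext rfl (by simpa using him)
  rw [e, Complex.norm_real, Real.norm_of_nonneg hre.le, re_charFun_eq_integral_cos]
  refine (hcd t (ht.trans (min_le_left _ _))).trans ?_
  linarith [Real.add_one_le_exp (-c * ‖t‖ ^ 2)]

lemma charFun_map_partialSum {E : Type*} [NormedAddCommGroup E] [InnerProductSpace ℝ E]
    [MeasurableSpace E] [BorelSpace E] [SecondCountableTopology E]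
    (μ : Measure E) [IsProbabilityMeasure μ] (n : ℕ) (t : E) :
    charFun ((iid μ).map (partialSum n)) t = charFun μ t ^ n := by
  have := congrFun (iIndepFun.charFun_map_fun_finsetSum_eq_prod (s := Finset.range n)
    (fun i _ => (measurable_pi_apply i).aemeasurable) (iIndepFun_iff_finset.1 (iIndepFun_eval_iid μ) _)) t
  simp only [Finset.prod_apply, Measure.infinitePi_map_eval, Finset.prod_const,
    Finset.card_range] at this
  exact this

/-- A smoothing inequality: concentration near the origin is controlled by the characteristic
function near the origin. -/
lemma measureReal_closedBall_mul_le {E : Type*} [NormedAddCommGroup E] [InnerProductSpace ℝ E]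
    [FiniteDimensional ℝ E] [MeasurableSpace E] [BorelSpace E]
    (ν : Measure E) [IsProbabilityMeasure ν] {R ρ : ℝ} (hR : R * ρ ≤ 1) :
    ν.real (Metric.closedBall 0 R) * (volume.real (Metric.closedBall (0 : E) ρ) / 2) ^ 2
      ≤ ∫ p, ‖charFun ν (p.1 - p.2)‖ ∂((volume.restrict (Metric.closedBall (0 : E) ρ)).prod
        (volume.restrict (Metric.closedBall (0 : E) ρ))) := by
  have : ProperSpace E := FiniteDimensional.proper_real E
  have : SecondCountableTopology E := secondCountable_of_proper
  set lam : Measure E := volume.restrict (Metric.closedBall (0 : E) ρ) with hlam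
  have hfin : IsFiniteMeasure lam := ⟨by simpa [hlam] using measure_closedBall_lt_top⟩
  have hcint {F : Type _} [MeasurableSpace F] (m : Measure F) [IsFiniteMeasure m] {f : F → ℝ}
      (hf : Measurable f) : Integrable (fun x => Real.cos (f x)) m :=
    Integrable.of_bound (by fun_prop) 1 (Eventually.of_forall fun y => Real.abs_cos_le_one _)
  have hsint {F : Type _} [MeasurableSpace F] (m : Measure F) [IsFiniteMeasure m] {f : F → ℝ}
      (hf : Measurable f) : Integrable (fun x => Real.sin (f x)) m :=
    Integrable.of_bound (by fun_prop) 1 (Eventually.of_forall fun y => Real.abs_sin_le_one _)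
  -- The right side is the squared modulus of the Fourier transform of `lam` at `y`, that is, the
  -- squared cosine integral plus the squared sine integral.
  have hG (y : E) : (∫ t, Real.cos (inner ℝ y t) ∂lam) ^ 2
      ≤ ∫ p, Real.cos (inner ℝ y (p.1 - p.2)) ∂(lam.prod lam) := by
    have e (p : E × E) : Real.cos (inner ℝ y (p.1 - p.2))
        = Real.cos (inner ℝ y p.1) * Real.cos (inner ℝ y p.2)
          + Real.sin (inner ℝ y p.1) * Real.sin (inner ℝ y p.2) := by
      rw [inner_sub_right, Real.cos_sub]
    simp_rw [e]
    rw [integral_add ((hcint lam (by fun_prop)).mul_prod (hcint lam (by fun_prop)))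
      ((hsint lam (by fun_prop)).mul_prod (hsint lam (by fun_prop))),
      integral_prod_mul (fun t => Real.cos (inner ℝ y t)) (fun t => Real.cos (inner ℝ y t)),
      integral_prod_mul (fun t => Real.sin (inner ℝ y t)) (fun t => Real.sin (inner ℝ y t))]
    nlinarith [mul_self_nonneg (∫ t, Real.sin (inner ℝ y t) ∂lam)]
  have hlow (y : E) (hy : y ∈ Metric.closedBall (0 : E) R) :
      volume.real (Metric.closedBall (0 : E) ρ) / 2 ≤ ∫ t, Real.cos (inner ℝ y t) ∂lam := by
    have hc : ∫ _t, (1 / 2 : ℝ) ∂lam ≤ ∫ t, Real.cos (inner ℝ y t) ∂lam := by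
      refine integral_mono_ae (integrable_const _) (hcint lam (by fun_prop)) ?_
      filter_upwards [ae_restrict_mem Metric.isClosed_closedBall.measurableSet] with t ht
      rw [mem_closedBall_zero_iff] at hy ht
      have h1 : |inner ℝ y t| ≤ 1 := (abs_real_inner_le_norm y t).trans
        ((mul_le_mul hy ht (norm_nonneg _) ((norm_nonneg _).trans hy)).trans hR)
      have h2 := Real.one_sub_sq_div_two_le_cos (x := inner ℝ y t)
      have h3 : (inner ℝ y t) ^ 2 ≤ 1 := (sq_le_one_iff_abs_le_one _).2 h1
      linarith
    rw [integral_const, hlam, measureReal_restrict_apply_univ, smul_eq_mul] at hc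
    linarith
  have hGint : Integrable (fun y => ∫ p, Real.cos (inner ℝ y (p.1 - p.2)) ∂(lam.prod lam)) ν :=
    (hcint (ν.prod (lam.prod lam)) (f := fun q => inner ℝ q.1 (q.2.1 - q.2.2))
      (by fun_prop)).integral_prod_left
  calc ν.real (Metric.closedBall 0 R) * (volume.real (Metric.closedBall (0 : E) ρ) / 2) ^ 2
      = ∫ y in Metric.closedBall 0 R, (volume.real (Metric.closedBall (0 : E) ρ) / 2) ^ 2 ∂ν := by
        rw [setIntegral_const, smul_eq_mul]
    _ ≤ ∫ y in Metric.closedBall 0 R, ∫ p, Real.cos (inner ℝ y (p.1 - p.2)) ∂(lam.prod lam) ∂ν := by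
        refine setIntegral_mono_on (integrable_const _) hGint.integrableOn
          Metric.isClosed_closedBall.measurableSet fun y hy => ?_
        exact (pow_le_pow_left₀ (by positivity) (hlow y hy) 2).trans (hG y)
    _ ≤ ∫ y, ∫ p, Real.cos (inner ℝ y (p.1 - p.2)) ∂(lam.prod lam) ∂ν :=
        setIntegral_le_integral hGint
          (Eventually.of_forall fun y => (sq_nonneg _).trans (hG y))
    _ = ∫ p, ∫ y, Real.cos (inner ℝ y (p.1 - p.2)) ∂ν ∂(lam.prod lam) :=
        integral_integral_swap (hcint (ν.prod (lam.prod lam))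
          (f := fun q => inner ℝ q.1 (q.2.1 - q.2.2)) (by fun_prop))
    _ ≤ ∫ p, ‖charFun ν (p.1 - p.2)‖ ∂(lam.prod lam) := by
        refine integral_mono ?_ ?_ fun p => ?_
        · exact (hcint (ν.prod (lam.prod lam))
            (f := fun q => inner ℝ q.1 (q.2.1 - q.2.2)) (by fun_prop)).integral_prod_right
        · refine Integrable.of_bound ?_ 1 (Eventually.of_forall fun p => ?_)
          · exact ((continuous_charFun (μ := ν)).comp
              (continuous_fst.sub continuous_snd)).norm.aestronglyMeasurable
          · rw [norm_norm]
            exact norm_charFun_le_one _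
        · dsimp only
          rw [← re_charFun_eq_integral_cos]
          exact Complex.re_le_norm _

lemma exists_measureReal_partialSum_le {μ : Measure (EuclideanSpace ℝ (Fin r))}
    [IsProbabilityMeasure μ] (h : FullySymmetric μ) (hpos : ∀ i, 0 < μ {y | y i ≠ 0})
    {R : ℝ} (hR : 0 ≤ R) : ∃ C : ℝ, ∀ n : ℕ, 0 < n →
      (iid μ).real {z | ‖partialSum n z‖ ≤ R} ≤ C * (1 / (n : ℝ) ^ ((r : ℝ) / 2)) := by
  obtain ⟨c, hc, δ, hδ, hφ⟩ := exists_norm_charFun_le_exp h hpos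
  -- Two constraints: differences of points of the `ρ`-ball stay within `δ`, where the Gaussian
  -- bound holds, and `R * ρ ≤ 1` for the smoothing inequality.
  set ρ : ℝ := min (δ / 2) (1 / (R + 1)) with hρdef
  have hρ : 0 < ρ := by positivity
  have hρδ : 2 * ρ ≤ δ := by linarith [min_le_left (δ / 2) (1 / (R + 1))]
  have hρR : R * ρ ≤ 1 := by
    have : ρ ≤ 1 / (R + 1) := min_le_right _ _
    calc R * ρ ≤ R * (1 / (R + 1)) := by gcongr
      _ ≤ 1 := by rw [mul_one_div, div_le_one (by positivity)]; linarith
  set v : ℝ := volume.real (Metric.closedBall (0 : EuclideanSpace ℝ (Fin r)) ρ) with hv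
  have hvpos : 0 < v := ENNReal.toReal_pos
    (Metric.measure_closedBall_pos _ _ hρ).ne' measure_closedBall_lt_top.ne
  refine ⟨(v * (Real.pi / c) ^ ((r : ℝ) / 2)) / (v / 2) ^ 2, fun n hn => ?_⟩
  have hn' : (0 : ℝ) < n := by exact_mod_cast hn
  set lam : Measure (EuclideanSpace ℝ (Fin r)) :=
    volume.restrict (Metric.closedBall (0 : EuclideanSpace ℝ (Fin r)) ρ) with hlam
  have hfin : IsFiniteMeasure lam := ⟨by simpa [hlam] using measure_closedBall_lt_top⟩
  have hprob : IsProbabilityMeasure ((iid μ).map (partialSum n)) :=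
    Measure.isProbabilityMeasure_map (measurable_partialSum n).aemeasurable
  have key := measureReal_closedBall_mul_le ((iid μ).map (partialSum n)) hρR
  rw [map_measureReal_apply (measurable_partialSum n) Metric.isClosed_closedBall.measurableSet]
    at key
  have hset : partialSum n ⁻¹' (Metric.closedBall (0 : EuclideanSpace ℝ (Fin r)) R)
      = {z | ‖partialSum n z‖ ≤ R} := by
    ext z; simp
  rw [hset] at key
  have hgi : Integrable (fun w : EuclideanSpace ℝ (Fin r) => Real.exp (-(c * n) * ‖w‖ ^ 2)) := by
    -- A non-integrable function has integral `0` by convention, whereas the Gaussian integral is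
    -- positive.
    by_contra hni
    have h0 := integral_undef hni
    rw [GaussianFourier.integral_rexp_neg_mul_sq_norm (by positivity)] at h0
    have : 0 < (Real.pi / (c * n)) ^
      ((Module.finrank ℝ (EuclideanSpace ℝ (Fin r)) : ℝ) / 2) := by positivity
    linarith
  have hbound : ∫ p, ‖charFun ((iid μ).map (partialSum n)) (p.1 - p.2)‖ ∂(lam.prod lam)
      ≤ v * (Real.pi / (c * n)) ^ ((r : ℝ) / 2) := by
    have hexpint : Integrable (fun p : EuclideanSpace ℝ (Fin r) × EuclideanSpace ℝ (Fin r) =>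
        Real.exp (-(c * n) * ‖p.1 - p.2‖ ^ 2)) (lam.prod lam) := by
      refine Integrable.of_bound (by fun_prop) 1 (Eventually.of_forall fun p => ?_)
      rw [Real.norm_of_nonneg (Real.exp_nonneg _)]
      exact Real.exp_le_one_iff.2 (by nlinarith [mul_pos hc hn', sq_nonneg ‖p.1 - p.2‖])
    calc ∫ p, ‖charFun ((iid μ).map (partialSum n)) (p.1 - p.2)‖ ∂(lam.prod lam)
        ≤ ∫ p, Real.exp (-(c * n) * ‖p.1 - p.2‖ ^ 2) ∂(lam.prod lam) := by
          refine integral_mono_of_nonneg (Eventually.of_forall fun p => norm_nonneg _) hexpint ?_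
          rw [hlam, Measure.prod_restrict]
          filter_upwards [ae_restrict_mem (Metric.isClosed_closedBall.measurableSet.prod
            Metric.isClosed_closedBall.measurableSet)] with p hp
          rw [charFun_map_partialSum, norm_pow]
          have hp1 : ‖p.1‖ ≤ ρ := mem_closedBall_zero_iff.1 hp.1
          have hp2 : ‖p.2‖ ≤ ρ := mem_closedBall_zero_iff.1 hp.2
          refine (pow_le_pow_left₀ (norm_nonneg _)
            (hφ _ ((norm_sub_le _ _).trans (by linarith))) n).trans_eq ?_
          rw [← Real.exp_nat_mul]
          congr 1
          ring
      _ = ∫ t, ∫ u, Real.exp (-(c * n) * ‖t - u‖ ^ 2) ∂lam ∂lam := integral_prod _ hexpint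
      _ ≤ ∫ _t, (Real.pi / (c * n)) ^ ((r : ℝ) / 2) ∂lam := by
          refine integral_mono hexpint.integral_prod_left (integrable_const _) fun t => ?_
          have h1 : Integrable
              (fun u : EuclideanSpace ℝ (Fin r) => Real.exp (-(c * n) * ‖t - u‖ ^ 2)) :=
            hgi.comp_sub_left t
          refine (setIntegral_le_integral h1
            (Eventually.of_forall fun u => Real.exp_nonneg _)).trans_eq ?_
          rw [integral_sub_left_eq_self
            (fun w : EuclideanSpace ℝ (Fin r) => Real.exp (-(c * n) * ‖w‖ ^ 2)) volume t,
            GaussianFourier.integral_rexp_neg_mul_sq_norm (by positivity)]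
          simp
      _ = v * (Real.pi / (c * n)) ^ ((r : ℝ) / 2) := by
          rw [integral_const, smul_eq_mul, hlam, measureReal_restrict_apply_univ]
  have h2 : (iid μ).real {z | ‖partialSum n z‖ ≤ R}
      ≤ v * (Real.pi / (c * n)) ^ ((r : ℝ) / 2) / (v / 2) ^ 2 := by
    rw [le_div_iff₀ (by positivity)]
    exact key.trans hbound
  refine h2.trans_eq ?_
  rw [← div_div, Real.div_rpow (by positivity) hn'.le]
  ring

theorem FullySymmetric.ae_tendsto_norm_partialSum {μ : Measure (EuclideanSpace ℝ (Fin r))}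
    [IsProbabilityMeasure μ] (h : FullySymmetric μ) (hpos : ∀ i, 0 < μ {y | y i ≠ 0})
    (hr : 3 ≤ r) :
    ∀ᵐ z ∂(iid μ), Tendsto (fun n => ‖partialSum n z‖) atTop atTop := by
  have hR (R : ℕ) : ∀ᵐ z ∂(iid μ), ∀ᶠ n in atTop, (R : ℝ) < ‖partialSum n z‖ := by
    obtain ⟨C, hC⟩ := exists_measureReal_partialSum_le h hpos (R := R) (by positivity)
    have hsum : Summable fun n : ℕ => (iid μ).real {z | ‖partialSum n z‖ ≤ R} := by
      have h1 : Summable fun n : ℕ => C * (1 / (n : ℝ) ^ ((r : ℝ) / 2)) := by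
        refine (Real.summable_one_div_nat_rpow.2 ?_).mul_left C
        have : (3 : ℝ) ≤ r := by exact_mod_cast hr
        linarith
      refine (summable_nat_add_iff 1).1 (Summable.of_nonneg_of_le
        (fun n => measureReal_nonneg) (fun n => hC (n + 1) n.succ_pos) ?_)
      exact (summable_nat_add_iff 1).2 h1
    have hne : ∑' n, iid μ {z | ‖partialSum n z‖ ≤ R} ≠ ⊤ := by
      have := hsum.tsum_ofReal_ne_top
      simpa only [ofReal_measureReal (measure_ne_top _ _)] using this
    filter_upwards [ae_eventually_notMem hne] with z hz
    filter_upwards [hz] with n hn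
    exact not_le.1 hn
  filter_upwards [ae_all_iff.2 hR] with z hz
  refine tendsto_atTop.2 fun b => ?_
  obtain ⟨N, hN⟩ := exists_nat_ge b
  filter_upwards [hz N] with n hn
  exact hN.trans hn.le

lemma norm_coordAbs (x : EuclideanSpace ℝ (Fin r)) : ‖coordAbs x‖ = ‖x‖ := by
  simp [EuclideanSpace.norm_eq, coordAbs]

theorem FullySymmetric.isTransient_rrw {μ : Measure (EuclideanSpace ℝ (Fin r))}
    [IsProbabilityMeasure μ] (h : FullySymmetric μ) (hpos : ∀ i, 0 < μ {y | y i ≠ 0})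
    (hr : 3 ≤ r) {Ω : Type*} [MeasurableSpace Ω]
    {P : Measure Ω} {Y : ℕ → Ω → EuclideanSpace ℝ (Fin r)}
    (hlaw : ∀ n, HasLaw (Y n) μ P) (hindep : iIndepFun Y P) :
    IsTransient P (stateSpace μ) (rrw Y) := by
  intro x hx
  refine h.ae_rrw hlaw hindep (fun i => (hx i).1)
    (Q := fun X => Tendsto (fun n => dist (X n) x) atTop atTop) ?_
  filter_upwards [h.ae_tendsto_norm_partialSum hpos hr] with z hz
  refine tendsto_atTop_mono (f := fun n => ‖partialSum n z‖ + -(2 * ‖x‖)) (fun n => ?_)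
    (tendsto_atTop_add_const_right _ _ hz)
  have h1 : ‖coordAbs (x - partialSum n z)‖ - ‖x‖ ≤ dist (coordAbs (x - partialSum n z)) x := by
    rw [dist_eq_norm]
    exact norm_sub_norm_le _ _
  have h2 : ‖partialSum n z‖ - ‖x‖ ≤ ‖x - partialSum n z‖ := by
    rw [norm_sub_rev]
    exact norm_sub_norm_le _ _
  rw [norm_coordAbs] at h1
  linarith

end Transience

/-! ### Recurrent points of a random walk and the group of their translations. -/

section Recurrence

variable {E : Type*} [NormedAddCommGroup E] [MeasurableSpace E] [BorelSpace E]
  [SecondCountableTopology E]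

/-- The points all of whose neighbourhoods are visited infinitely often by the random walk with
increments of law `μ`. -/
def recurrentPoints (μ : Measure E) : Set E :=
  {p | ∀ δ > 0, ∀ k : ℕ, iid μ {z | ∀ m ≥ k, δ ≤ ‖partialSum m z - p‖} = 0}

lemma measurableSet_forall_le_norm_partialSum_sub (δ : ℝ) (k : ℕ) (p : E) :
    MeasurableSet {z : ℕ → E | ∀ m ≥ k, δ ≤ ‖partialSum m z - p‖} := by
  simp only [Set.ofPred_forall]
  exact .iInter fun m => .iInter fun _ => measurableSet_le measurable_const (by fun_prop)

/-- A random walk with infinite Green function on balls around the origin returns to each of them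
infinitely often: decompose according to the last visit. -/
lemma zero_mem_recurrentPoints {μ : Measure E} [IsProbabilityMeasure μ]
    (h : ∀ δ > 0, ∑' n, iid μ {z : ℕ → E | ‖partialSum n z‖ < δ} = ⊤) :
    (0 : E) ∈ recurrentPoints μ := by
  intro δ' hδ' k
  -- If the position at time `n` is within `δ` of `0` and the later increments sum to at least `δ'`,
  -- the walk is then at distance at least `δ' - δ = δ`.
  set δ := δ' / 2 with hδdef
  have hδ : 0 < δ := by positivity
  set B : Set (ℕ → E) := {z | ∀ m ≥ k, δ' ≤ ‖partialSum m z - 0‖} with hB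
  have hBm : MeasurableSet B := measurableSet_forall_le_norm_partialSum_sub _ _ _
  let D : ℕ → Set (ℕ → E) := fun n =>
    {z | ‖partialSum n z‖ < δ} ∩ {z | ∀ m ≥ n + k, δ ≤ ‖partialSum m z - 0‖}
  have hDm (n : ℕ) : MeasurableSet (D n) :=
    (measurableSet_lt (by fun_prop) measurable_const).inter
      (measurableSet_forall_le_norm_partialSum_sub _ _ _)
  have hlow (n : ℕ) : iid μ {z : ℕ → E | ‖partialSum n z‖ < δ} * iid μ B ≤ iid μ (D n) := by
    have := iid_partialSum_shift μ n (A := Metric.ball (0 : E) δ) measurableSet_ball hBm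
    simp only [mem_ball_zero_iff] at this
    rw [← this]
    refine measure_mono fun z hz => ⟨hz.1, fun m hm => ?_⟩
    obtain ⟨j, rfl⟩ := Nat.exists_eq_add_of_le (show n ≤ m by omega)
    have h1 := hz.2 j (by omega)
    have h2 : ‖partialSum n z‖ < δ := hz.1
    rw [sub_zero] at h1 ⊢
    rw [partialSum_add]
    have h3 := norm_sub_le (partialSum n z + partialSum j fun k => z (n + k)) (partialSum n z)
    rw [add_sub_cancel_left] at h3
    linarith
  have hup : ∑' n, iid μ (D n) ≤ k := by
    calc ∑' n, iid μ (D n) = ∑' n, ∫⁻ z, (D n).indicator 1 z ∂(iid μ) := by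
          simp_rw [lintegral_indicator_one (hDm _)]
      _ = ∫⁻ z, ∑' n, (D n).indicator 1 z ∂(iid μ) := by
          rw [lintegral_tsum fun n => (measurable_one.indicator (hDm n)).aemeasurable]
      _ ≤ ∫⁻ _z, (k : ENNReal) ∂(iid μ) := by
          refine lintegral_mono fun z => ?_
          by_cases hz : ∃ n, z ∈ D n
          · classical
            set n₀ := Nat.find hz
            have hn₀ : z ∈ D n₀ := Nat.find_spec hz
            -- After the first `n₀` with `z ∈ D n₀`, the ball is not visited from time `n₀ + k` on;
            -- so at most `k` of the events `D n` occur together.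
            rw [tsum_eq_sum (s := Finset.Ico n₀ (n₀ + k))]
            · calc ∑ n ∈ Finset.Ico n₀ (n₀ + k), (D n).indicator (1 : (ℕ → E) → ENNReal) z
                  ≤ ∑ _n ∈ Finset.Ico n₀ (n₀ + k), 1 :=
                    Finset.sum_le_sum fun n _ => Set.indicator_le_self' (by simp) z
                _ = k := by simp
            · intro n hn
              refine Set.indicator_of_notMem (fun hzn => hn ?_) _
              rw [Finset.mem_Ico]
              refine ⟨Nat.find_min' hz hzn, ?_⟩
              by_contra hcon
              have h1 := hn₀.2 n (not_lt.1 hcon)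
              have h2 : ‖partialSum n z‖ < δ := hzn.1
              rw [sub_zero] at h1
              linarith
          · push Not at hz
            simp [Set.indicator_of_notMem (hz _)]
      _ = k := by simp
  have hmul : (∑' n, iid μ {z : ℕ → E | ‖partialSum n z‖ < δ}) * iid μ B ≤ k := by
    rw [← ENNReal.tsum_mul_right]
    exact (ENNReal.tsum_le_tsum hlow).trans hup
  rw [h δ hδ] at hmul
  by_contra hne
  rw [ENNReal.top_mul hne] at hmul
  exact absurd hmul (by simp)

/-- With positive probability the first step lands near `y`. If the walk could then avoid `p - y`
after time `k`, the whole walk would avoid `p` with positive probability. -/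
lemma sub_mem_recurrentPoints {μ : Measure E} [IsProbabilityMeasure μ] {p y : E}
    (hp : p ∈ recurrentPoints μ) (hy : y ∈ μ.support) : p - y ∈ recurrentPoints μ := by
  intro δ hδ k
  have hBm := measurableSet_forall_le_norm_partialSum_sub δ k (p - y)
  have h1 := iid_partialSum_shift μ 1 (A := Metric.ball y (δ / 2)) measurableSet_ball hBm
  have hpos : iid μ {z : ℕ → E | partialSum 1 z ∈ Metric.ball y (δ / 2)} ≠ 0 := by
    have h2 := (measurePreserving_eval_infinitePi (fun _ : ℕ => μ) 0).measure_preimage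
      (measurableSet_ball (x := y) (ε := δ / 2)).nullMeasurableSet
    have h3 : {z : ℕ → E | partialSum 1 z ∈ Metric.ball y (δ / 2)}
        = Function.eval 0 ⁻¹' Metric.ball y (δ / 2) := by
      ext z
      simp [partialSum]
    rw [h3, h2]
    exact ((Measure.mem_support_iff_forall y).1 hy _ (Metric.ball_mem_nhds y (by positivity))).ne'
  have h0 : iid μ {z : ℕ → E | partialSum 1 z ∈ Metric.ball y (δ / 2) ∧
      (fun k => z (1 + k)) ∈ {z : ℕ → E | ∀ m ≥ k, δ ≤ ‖partialSum m z - (p - y)‖}} = 0 := by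
    refine measure_mono_null (fun z hz => ?_) (hp (δ / 2) (by positivity) (1 + k))
    intro m hm
    obtain ⟨j, rfl⟩ := Nat.exists_eq_add_of_le (show 1 ≤ m by omega)
    have h2 := hz.2 j (by omega)
    have h3 : ‖partialSum 1 z - y‖ < δ / 2 := mem_ball_iff_norm.1 hz.1
    have h4 := norm_sub_le (partialSum (1 + j) z - p) (partialSum 1 z - y)
    rw [partialSum_add] at h4 ⊢
    have h5 : partialSum 1 z + partialSum j (fun k => z (1 + k)) - p - (partialSum 1 z - y)
        = partialSum j (fun k => z (1 + k)) - (p - y) := by abel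
    rw [h5] at h4
    linarith
  rw [h0] at h1
  exact (mul_eq_zero.1 h1.symm).resolve_left hpos

/-- The translations that preserve the set of recurrent points. -/
def recurrenceGroup (μ : Measure E) : AddSubgroup E where
  carrier := {h | ∀ p ∈ recurrentPoints μ, p + h ∈ recurrentPoints μ ∧ p - h ∈ recurrentPoints μ}
  zero_mem' := fun p hp => by simpa using hp
  add_mem' := fun {a b} ha hb p hp => by
    rw [← add_assoc, ← sub_sub]
    exact ⟨(hb _ (ha p hp).1).1, (hb _ (ha p hp).2).2⟩
  neg_mem' := fun {a} ha p hp => by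
    rw [sub_neg_eq_add, ← sub_eq_add_neg]
    exact (ha p hp).symm

omit [BorelSpace E] [SecondCountableTopology E] in
lemma isClosed_recurrentPoints (μ : Measure E) : IsClosed (recurrentPoints μ) := by
  refine isClosed_of_closure_subset fun p hp δ hδ k => ?_
  obtain ⟨q, hq, hpq⟩ := Metric.mem_closure_iff.1 hp (δ / 2) (by positivity)
  refine measure_mono_null (fun z hz => ?_) (hq (δ / 2) (by positivity) k)
  intro m hm
  have h1 := hz m hm
  have h2 := norm_sub_le_norm_sub_add_norm_sub (partialSum m z) q p
  rw [dist_eq_norm, norm_sub_rev] at hpq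
  linarith

omit [BorelSpace E] [SecondCountableTopology E] in
lemma isClosed_recurrenceGroup (μ : Measure E) : IsClosed (recurrenceGroup μ : Set E) := by
  have : (recurrenceGroup μ : Set E) = ⋂ p ∈ recurrentPoints μ,
      {h | p + h ∈ recurrentPoints μ} ∩ {h | p - h ∈ recurrentPoints μ} := by
    ext h
    simp only [Set.mem_iInter]
    rfl
  rw [this]
  exact isClosed_biInter fun p _ =>
    ((isClosed_recurrentPoints μ).preimage (continuous_const.add continuous_id)).inter
      ((isClosed_recurrentPoints μ).preimage (continuous_const.sub continuous_id))

omit [BorelSpace E] [SecondCountableTopology E] in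
lemma recurrenceGroup_subset {μ : Measure E} (h0 : (0 : E) ∈ recurrentPoints μ) :
    (recurrenceGroup μ : Set E) ⊆ recurrentPoints μ := fun h hh => by
  simpa using (hh 0 h0).1

lemma mem_support_of_map_eq {X : Type*} [TopologicalSpace X] [MeasurableSpace X] [BorelSpace X]
    {μ : Measure X} {f : X → X} (hf : Continuous f) (h : μ.map f = μ) {y : X}
    (hy : y ∈ μ.support) : f y ∈ μ.support := by
  rw [Measure.mem_support_iff_forall] at hy ⊢
  intro U hU
  refine lt_of_lt_of_le ?_ (measure_mono interior_subset)
  rw [← h, Measure.map_apply hf.measurable isOpen_interior.measurableSet]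
  exact hy _ (hf.continuousAt.preimage_mem_nhds (interior_mem_nhds.2 hU))

lemma support_subset_recurrenceGroup {μ : Measure E} [IsProbabilityMeasure μ]
    (h : μ.map (fun y => -y) = μ) : μ.support ⊆ recurrenceGroup μ := fun y hy p hp =>
  ⟨by simpa using sub_mem_recurrentPoints hp (mem_support_of_map_eq continuous_neg h hy),
    sub_mem_recurrentPoints hp hy⟩

end Recurrence

/-! ### Divergence of the Green function from concentration. -/

section Divergence

variable {r : ℕ}

/-- Two independent points in the same cell of side `η` are `δ`-close. The `(2 * N + 1) ^ r` cells
meeting the box carry mass at least `1 / 2`, so Cauchy–Schwarz bounds the sum of their squared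
masses from below. -/
lemma prod_measureReal_norm_sub_lt_ge (ν : Measure (EuclideanSpace ℝ (Fin r)))
    [IsProbabilityMeasure ν] {δ η : ℝ} (hη : 0 < η)
    (hδ : ∀ y : EuclideanSpace ℝ (Fin r), (∀ i, |y i| < η) → ‖y‖ < δ) (N : ℕ)
    (hN : 1 / 2 ≤ ν.real {y | ∀ i, |y i| ≤ N * η}) :
    1 / (4 * (2 * N + 1 : ℝ) ^ r) ≤ (ν.prod ν).real {p | ‖p.1 - p.2‖ < δ} := by
  classical
  let cell : (Fin r → ℤ) → Set (EuclideanSpace ℝ (Fin r)) := fun c => {y | ∀ i, ⌊y i / η⌋ = c i}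
  have hcm (c : Fin r → ℤ) : MeasurableSet (cell c) := by
    simp only [cell, Set.ofPred_forall]
    refine .iInter fun i => ?_
    have : Measurable fun y : EuclideanSpace ℝ (Fin r) => ⌊y i / η⌋ :=
      Int.measurable_floor.comp (by fun_prop)
    exact this (measurableSet_singleton (c i))
  let J : Finset (Fin r → ℤ) := Fintype.piFinset fun _ => Finset.Icc (-(N : ℤ)) N
  have hJ : (J.card : ℝ) = (2 * N + 1 : ℝ) ^ r := by
    have : (Finset.Icc (-(N : ℤ)) N).card = 2 * N + 1 := by
      rw [Int.card_Icc]; omega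
    simp [J, Fintype.card_piFinset, this]
  have h1 : 1 / 2 ≤ ∑ c ∈ J, ν.real (cell c) := by
    refine hN.trans (le_trans (measureReal_mono ?_ (measure_ne_top _ _))
      (measureReal_biUnion_finset_le J cell))
    intro y hy
    refine Set.mem_iUnion₂.2 ⟨fun i => ⌊y i / η⌋, ?_, fun i => rfl⟩
    refine Fintype.mem_piFinset.2 fun i => Finset.mem_Icc.2 ?_
    have hyi := abs_le.1 (hy i)
    constructor
    · rw [Int.le_floor, le_div_iff₀ hη]
      push_cast
      linarith [hyi.1]
    · have : y i / η ≤ N := (div_le_iff₀ hη).2 hyi.2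
      have h5 : ((⌊y i / η⌋ : ℤ) : ℝ) ≤ ((N : ℤ) : ℝ) := (Int.floor_le _).trans (by simpa using this)
      exact Int.cast_le.1 h5
  have h2 : ∑ c ∈ J, ν.real (cell c) ^ 2 ≤ (ν.prod ν).real {p | ‖p.1 - p.2‖ < δ} := by
    have e (c : Fin r → ℤ) : ν.real (cell c) ^ 2 = (ν.prod ν).real (cell c ×ˢ cell c) := by
      rw [measureReal_prod_prod, sq]
    simp_rw [e]
    rw [← measureReal_biUnion_finset]
    · refine measureReal_mono ?_
      intro p hp
      obtain ⟨c, -, hc⟩ := Set.mem_iUnion₂.1 hp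
      refine hδ _ fun i => ?_
      have h3 : ⌊p.1 i / η⌋ = ⌊p.2 i / η⌋ := (hc.1 i).trans (hc.2 i).symm
      have h4 := Int.abs_sub_lt_one_of_floor_eq_floor h3
      rw [← sub_div, abs_div, abs_of_pos hη, div_lt_one hη] at h4
      exact h4
    · intro c _ d _ hcd
      refine Set.disjoint_left.2 fun p hp hq => hcd ?_
      funext i
      exact (hp.1 i).symm.trans (hq.1 i)
    · exact fun c _ => (hcm c).prod (hcm c)
  have h3 := sq_sum_le_card_mul_sum_sq (s := J) (f := fun c => ν.real (cell c))
  rw [hJ] at h3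
  have hK : (0 : ℝ) < (2 * N + 1 : ℝ) ^ r := by positivity
  rw [div_le_iff₀ (by positivity)]
  nlinarith

lemma map_neg_map_partialSum {E : Type*} [NormedAddCommGroup E] [MeasurableSpace E] [BorelSpace E]
    [SecondCountableTopology E] {μ : Measure E} [IsProbabilityMeasure μ]
    (h : μ.map (fun y => -y) = μ) (n : ℕ) :
    ((iid μ).map (partialSum n)).map (fun y => -y) = (iid μ).map (partialSum n) := by
  have h1 : (iid μ).map (fun z k => -(z k)) = iid μ := by
    have := Measure.infinitePi_map_pi (fun _ : ℕ => μ) (f := fun _ y => -y)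
      (fun _ => measurable_neg)
    rwa [h] at this
  conv_rhs => rw [← h1]
  rw [Measure.map_map (by fun_prop) (by fun_prop), Measure.map_map (by fun_prop) (by fun_prop)]
  congr 1
  ext z
  simp [partialSum]

/-- The increments from time `n` to `2n` have a sum independent of the position at time `n`; by
symmetry it is minus a copy of that position. -/
lemma measure_partialSum_add_self {E : Type*} [NormedAddCommGroup E] [MeasurableSpace E]
    [BorelSpace E] [SecondCountableTopology E] {μ : Measure E} [IsProbabilityMeasure μ]
    (h : μ.map (fun y => -y) = μ) (n : ℕ) (δ : ℝ) :
    iid μ {z : ℕ → E | ‖partialSum (n + n) z‖ < δ}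
      = (((iid μ).map (partialSum n)).prod ((iid μ).map (partialSum n)))
          {p | ‖p.1 - p.2‖ < δ} := by
  have hprob : IsProbabilityMeasure ((iid μ).map (partialSum n : (ℕ → E) → E)) :=
    Measure.isProbabilityMeasure_map (measurable_partialSum n).aemeasurable
  have h1 : MeasurePreserving (fun z : ℕ → E => -partialSum n z) (iid μ)
      ((iid μ).map (partialSum n)) := by
    refine ⟨by fun_prop, ?_⟩
    conv_rhs => rw [← map_neg_map_partialSum h n]
    rw [Measure.map_map (by fun_prop) (by fun_prop)]
    rfl
  have h2 := ((MeasurePreserving.id ((iid μ).map (partialSum n))).prod h1).comp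
    (measurePreserving_partialSum_shift μ n)
  rw [← h2.measure_preimage (measurableSet_lt (by fun_prop) (by fun_prop)).nullMeasurableSet]
  congr 1
  ext z
  simp [partialSum_add]

/-- If the random walk is concentrated on boxes of volume of order `n` at time `n`, then its Green
function on balls around the origin is infinite. -/
lemma tsum_measure_norm_partialSum_lt_eq_top {μ : Measure (EuclideanSpace ℝ (Fin r))}
    [IsProbabilityMeasure μ] (h : μ.map (fun y => -y) = μ)
    (hconc : ∀ η > 0, ∃ C : ℝ, 0 < C ∧ ∃ N : ℕ → ℕ, ∀ᶠ n in atTop,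
      (2 * N n + 1 : ℝ) ^ r ≤ C * n ∧
      1 / 2 ≤ (iid μ).real {z | ∀ i, |partialSum n z i| ≤ N n * η}) {δ : ℝ} (hδ : 0 < δ) :
    ∑' n, iid μ {z : ℕ → EuclideanSpace ℝ (Fin r) | ‖partialSum n z‖ < δ} = ⊤ := by
  set η : ℝ := δ / (r + 1) with hηdef
  have hη : 0 < η := by positivity
  have hηδ (y : EuclideanSpace ℝ (Fin r)) (hy : ∀ i, |y i| < η) : ‖y‖ < δ := by
    have h1 : ‖y‖ ^ 2 ≤ r * η ^ 2 := by
      rw [EuclideanSpace.real_norm_sq_eq]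
      calc ∑ i, y i ^ 2 ≤ ∑ _i : Fin r, η ^ 2 :=
            Finset.sum_le_sum fun i _ => sq_le_sq.2 ((hy i).le.trans (le_abs_self η))
        _ = r * η ^ 2 := by simp
    have h2 : δ = (r + 1) * η := by rw [hηdef]; field_simp
    refine lt_of_pow_lt_pow_left₀ 2 hδ.le (h1.trans_lt ?_)
    rw [h2, mul_pow]
    have : (r : ℝ) < (r + 1) ^ 2 := by nlinarith [(Nat.cast_nonneg r : (0 : ℝ) ≤ r)]
    exact mul_lt_mul_of_pos_right this (by positivity)
  obtain ⟨C, hC, N, hN⟩ := hconc η hη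
  by_contra hne
  -- Even times suffice: their terms dominate a multiple of the harmonic series.
  have hne2 : ∑' n, iid μ {z : ℕ → EuclideanSpace ℝ (Fin r) | ‖partialSum (n + n) z‖ < δ} ≠ ⊤ :=
    ne_top_of_le_ne_top hne (ENNReal.tsum_comp_le_tsum_of_injective
      (f := fun n : ℕ => n + n) (fun a b hab => by dsimp only at hab; omega) _)
  have hsum := ENNReal.summable_toReal hne2
  have hdiv : Summable fun n : ℕ => 1 / (4 * C) * (1 / (n : ℝ)) := by
    refine hsum.of_norm_bounded_eventually_nat ?_
    filter_upwards [hN, eventually_gt_atTop 0] with n hn hn0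
    have hn0' : (0 : ℝ) < n := by exact_mod_cast hn0
    have hprob : IsProbabilityMeasure ((iid μ).map (partialSum n)) :=
      Measure.isProbabilityMeasure_map (measurable_partialSum n).aemeasurable
    have h1 := prod_measureReal_norm_sub_lt_ge ((iid μ).map (partialSum n)) hη hηδ (N n) (by
      rw [map_measureReal_apply (measurable_partialSum n)]
      · exact hn.2
      · simp only [Set.ofPred_forall]
        exact .iInter fun i => measurableSet_le (by fun_prop) measurable_const)
    rw [Real.norm_of_nonneg (by positivity), measure_partialSum_add_self h]
    refine le_trans ?_ h1
    rw [one_div_mul_one_div]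
    refine one_div_le_one_div_of_le (by positivity) ?_
    linarith [hn.1]
  have := (summable_mul_left_iff (by positivity)).1 hdiv
  exact Real.not_summable_one_div_natCast this

end Divergence

/-! ### Concentration in dimensions one and two. -/

section Concentration

lemma integral_eq_zero_of_map_neg {E F : Type*} [NormedAddCommGroup E] [MeasurableSpace E]
    [BorelSpace E] [NormedAddCommGroup F] [NormedSpace ℝ F] {μ : Measure E}
    (h : μ.map (fun y => -y) = μ) {f : E → F} (hf : ∀ y, f (-y) = -f y) :
    ∫ y, f y ∂μ = 0 := by
  have h1 : ∫ y, f y ∂μ = -∫ y, f y ∂μ := by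
    conv_lhs => rw [← h]
    rw [show (fun y : E => -y) = Homeomorph.neg E from rfl,
      (Homeomorph.neg E).measurableEmbedding.integral_map (μ := μ) f]
    simp [hf, integral_neg]
  have h2 : (2 : ℝ) • ∫ y, f y ∂μ = 0 := by
    rw [two_smul]
    nth_rewrite 1 [h1]
    exact neg_add_cancel _
  exact (smul_eq_zero.1 h2).resolve_left two_ne_zero

lemma exists_concentration_one {μ : Measure (EuclideanSpace ℝ (Fin 1))} [IsProbabilityMeasure μ]
    (h : μ.map (fun y => -y) = μ) (hint : Integrable (fun y => y) μ) {η : ℝ} (hη : 0 < η) :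
    ∃ C : ℝ, 0 < C ∧ ∃ N : ℕ → ℕ, ∀ᶠ n in atTop,
      (2 * N n + 1 : ℝ) ^ 1 ≤ C * n ∧
      1 / 2 ≤ (iid μ).real {z | ∀ i, |partialSum n z i| ≤ N n * η} := by
  have hmean : ∫ y, y ∂μ = 0 := integral_eq_zero_of_map_neg h fun _ => rfl
  have hev (i : ℕ) := measurePreserving_eval_infinitePi (fun _ : ℕ => μ) i
  have hslln := strong_law_ae (μ := iid μ)
    (fun (i : ℕ) (z : ℕ → EuclideanSpace ℝ (Fin 1)) => z i)
    ((hev 0).integrable_comp_of_integrable hint)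
    (fun i j hij => (iIndepFun_eval_iid μ).indepFun hij)
    (fun i => ⟨(measurable_pi_apply i).aemeasurable, (measurable_pi_apply 0).aemeasurable,
      (hev i).map_eq.trans (hev 0).map_eq.symm⟩)
  have h0 : ∫ z, z 0 ∂(iid μ) = 0 := by
    rw [← hmean]
    conv_rhs => rw [← (hev 0).map_eq]
    rw [integral_map (hev 0).aemeasurable (by fun_prop)]
  rw [h0] at hslln
  have hm := tendstoInMeasure_of_tendsto_ae (fun n => by fun_prop) hslln 1 one_pos
  obtain ⟨K, hK⟩ := exists_nat_ge (1 / η)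
  -- Since `K * η ≥ 1`, the box has radius at least `n`, and the law of large numbers with mean `0`
  -- gives `|S n| < n` with probability tending to `1`.
  refine ⟨2 * K + 1, by positivity, fun n => n * K, ?_⟩
  filter_upwards [hm.eventually_lt_const (show (0 : ENNReal) < ENNReal.ofReal (1 / 2) by simp),
    eventually_gt_atTop 0] with n hn hn0
  have hn0' : (1 : ℝ) ≤ n := by exact_mod_cast hn0
  refine ⟨by push_cast; nlinarith [(Nat.cast_nonneg K : (0 : ℝ) ≤ K)], ?_⟩
  set A : Set (ℕ → EuclideanSpace ℝ (Fin 1)) :=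
    {z | ∀ i, |partialSum n z i| ≤ ((n * K : ℕ) : ℝ) * η} with hA
  have hAm : MeasurableSet A := by
    simp only [hA, Set.ofPred_forall]
    exact .iInter fun i => measurableSet_le (by fun_prop) measurable_const
  have hAc : (iid μ).real Aᶜ ≤ 1 / 2 := by
    refine ENNReal.toReal_le_of_le_ofReal (by norm_num) (le_trans (measure_mono ?_) hn.le)
    intro z hz
    simp only [hA, Set.mem_compl_iff, Set.mem_ofPred_eq, not_forall, not_le] at hz
    obtain ⟨i, hi⟩ := hz
    have h1 : (n : ℝ) ≤ ‖partialSum n z‖ := by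
      refine le_trans ?_ (hi.le.trans (PiLp.norm_apply_le (partialSum n z) i))
      push_cast
      rw [mul_assoc]
      refine le_mul_of_one_le_right (by positivity) ?_
      rwa [div_le_iff₀ hη] at hK
    have h2 : (1 : ℝ) ≤ dist ((n : ℝ)⁻¹ • ∑ i ∈ Finset.range n, z i) 0 := by
      rw [dist_zero_right, norm_smul, norm_inv, RCLike.norm_natCast, ← div_eq_inv_mul,
        le_div_iff₀ (by positivity), one_mul]
      exact h1
    rw [Set.mem_ofPred_eq, edist_dist]
    exact ENNReal.one_le_ofReal.2 h2
  have := probReal_compl_eq_one_sub hAm (μ := iid μ)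
  linarith

lemma memLp_partialSum_apply {r : ℕ} {μ : Measure (EuclideanSpace ℝ (Fin r))}
    [IsProbabilityMeasure μ] {i : Fin r} (hL : MemLp (fun y => y i) 2 μ) (k : ℕ) :
    MemLp (fun z : ℕ → EuclideanSpace ℝ (Fin r) => z k i) 2 (iid μ) :=
  hL.comp_measurePreserving (measurePreserving_eval_infinitePi (fun _ : ℕ => μ) k)

lemma measureReal_le_abs_partialSum {r : ℕ} {μ : Measure (EuclideanSpace ℝ (Fin r))}
    [IsProbabilityMeasure μ] (h : μ.map (fun y => -y) = μ) {i : Fin r}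
    (hL : MemLp (fun y => y i) 2 μ) (n : ℕ) {c : ℝ} (hc : 0 < c) :
    (iid μ).real {z | c ≤ |partialSum n z i|} ≤ n * Var[fun y => y i; μ] / c ^ 2 := by
  have hev (k : ℕ) := measurePreserving_eval_infinitePi (fun _ : ℕ => μ) k
  have hS : (fun z : ℕ → EuclideanSpace ℝ (Fin r) => partialSum n z i)
      = ∑ k ∈ Finset.range n, fun z : ℕ → EuclideanSpace ℝ (Fin r) => z k i := by
    ext z
    simp [partialSum]
  have hSL : MemLp (fun z : ℕ → EuclideanSpace ℝ (Fin r) => partialSum n z i) 2 (iid μ) := by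
    rw [hS]
    exact memLp_finsetSum' _ fun k _ => memLp_partialSum_apply hL k
  have hmean : ∫ z, partialSum n z i ∂(iid μ) = 0 := by
    rw [← integral_map (f := fun y : EuclideanSpace ℝ (Fin r) => y i)
      (measurable_partialSum n).aemeasurable (by fun_prop)]
    exact integral_eq_zero_of_map_neg (map_neg_map_partialSum h n) fun y => rfl
  have hvar : Var[fun z : ℕ → EuclideanSpace ℝ (Fin r) => partialSum n z i; iid μ]
      = n * Var[fun y => y i; μ] := by
    rw [hS, IndepFun.variance_sum (fun k _ => memLp_partialSum_apply hL k)]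
    · have (k : ℕ) : Var[fun z : ℕ → EuclideanSpace ℝ (Fin r) => z k i; iid μ]
          = Var[fun y => y i; μ] := by
        conv_rhs => rw [← (hev k).map_eq]
        rw [variance_map (by fun_prop) (hev k).aemeasurable]
        rfl
      simp [this]
    · intro k _ l _ hkl
      exact ((iIndepFun_eval_iid μ).indepFun hkl).comp (φ := fun y => y i) (ψ := fun y => y i)
        (by fun_prop) (by fun_prop)
  have key := meas_ge_le_variance_div_sq hSL hc
  rw [hmean, hvar] at key
  simp only [sub_zero] at key
  exact ENNReal.toReal_le_of_le_ofReal
    (div_nonneg (mul_nonneg (Nat.cast_nonneg _) (variance_nonneg _ _)) (sq_nonneg _)) key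

lemma exists_concentration_two {μ : Measure (EuclideanSpace ℝ (Fin 2))} [IsProbabilityMeasure μ]
    (h : μ.map (fun y => -y) = μ) (hL : ∀ i, MemLp (fun y => y i) 2 μ) {η : ℝ} (hη : 0 < η) :
    ∃ C : ℝ, 0 < C ∧ ∃ N : ℕ → ℕ, ∀ᶠ n in atTop,
      (2 * N n + 1 : ℝ) ^ 2 ≤ C * n ∧
      1 / 2 ≤ (iid μ).real {z | ∀ i, |partialSum n z i| ≤ N n * η} := by
  set V : ℝ := ∑ i, Var[fun y => y i; μ] + 1 with hV
  have hV1 : 1 ≤ V := by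
    have : 0 ≤ ∑ i, Var[fun y => y i; μ] := Finset.sum_nonneg fun i _ => variance_nonneg _ _
    linarith
  -- The radius `√(2 * V * n)` makes the Chebyshev bounds sum to at most `1 / 2`. The constant comes
  -- from `(2a + 3)² ≤ 8a² + 18` with `a = √(2 * V * n) / η`.
  refine ⟨16 * V / η ^ 2 + 18, by positivity, fun n => ⌈√(2 * V * n) / η⌉₊, ?_⟩
  filter_upwards [eventually_gt_atTop 0] with n hn0
  have hn0' : (1 : ℝ) ≤ n := by exact_mod_cast hn0
  set c : ℝ := √(2 * V * n) with hc
  have hcpos : 0 < c := Real.sqrt_pos.2 (by positivity)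
  have hc2 : c ^ 2 = 2 * V * n := Real.sq_sqrt (by positivity)
  constructor
  · have h1 : (⌈c / η⌉₊ : ℝ) ≤ c / η + 1 := (Nat.ceil_lt_add_one (by positivity)).le
    have h2 : (2 * (⌈c / η⌉₊ : ℝ) + 1) ^ 2 ≤ (2 * (c / η) + 3) ^ 2 :=
      pow_le_pow_left₀ (by positivity) (by linarith) 2
    have h3 : (c / η) ^ 2 = 2 * V * n / η ^ 2 := by rw [div_pow, hc2]
    have h4 : (16 * V / η ^ 2 + 18) * n = 8 * (2 * V * n / η ^ 2) + 18 * n := by ring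
    rw [h4, ← h3]
    nlinarith [sq_nonneg (2 * (c / η) - 3)]
  · set A : Set (ℕ → EuclideanSpace ℝ (Fin 2)) :=
      {z | ∀ i, |partialSum n z i| ≤ (⌈c / η⌉₊ : ℝ) * η} with hA
    have hAm : MeasurableSet A := by
      simp only [hA, Set.ofPred_forall]
      exact .iInter fun i => measurableSet_le (by fun_prop) measurable_const
    have hsub : Aᶜ ⊆ ⋃ i ∈ (Finset.univ : Finset (Fin 2)), {z | c ≤ |partialSum n z i|} := by
      intro z hz
      simp only [hA, Set.mem_compl_iff, Set.mem_ofPred_eq, not_forall, not_le] at hz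
      obtain ⟨i, hi⟩ := hz
      refine Set.mem_iUnion₂.2 ⟨i, Finset.mem_univ i, le_trans ?_ hi.le⟩
      exact (div_le_iff₀ hη).1 (Nat.le_ceil _)
    have hAc : (iid μ).real Aᶜ ≤ 1 / 2 := by
      calc (iid μ).real Aᶜ ≤ ∑ i, (iid μ).real {z | c ≤ |partialSum n z i|} :=
            (measureReal_mono hsub (measure_ne_top _ _)).trans (measureReal_biUnion_finset_le _ _)
        _ ≤ ∑ i, n * Var[fun y => y i; μ] / c ^ 2 :=
            Finset.sum_le_sum fun i _ => measureReal_le_abs_partialSum h (hL i) n hcpos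
        _ = n * (∑ i, Var[fun y => y i; μ]) / c ^ 2 := by
            rw [Finset.mul_sum, Finset.sum_div]
        _ ≤ 1 / 2 := by
            rw [hc2, div_le_iff₀ (by positivity)]
            nlinarith
    have := probReal_compl_eq_one_sub hAm (μ := iid μ)
    linarith

theorem zero_mem_recurrentPoints_of_dim_le_two {r : ℕ} {μ : Measure (EuclideanSpace ℝ (Fin r))}
    [IsProbabilityMeasure μ] (h : μ.map (fun y => -y) = μ) (hr : r = 1 ∨ r = 2)
    (hint : Integrable (fun y => ‖y‖ ^ r) μ) : 0 ∈ recurrentPoints μ := by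
  refine zero_mem_recurrentPoints fun δ hδ => tsum_measure_norm_partialSum_lt_eq_top h ?_ hδ
  intro η hη
  rcases hr with rfl | rfl
  · refine exists_concentration_one h ?_ hη
    simp only [pow_one] at hint
    exact (integrable_norm_iff (by fun_prop)).1 hint
  · refine exists_concentration_two h (fun i => ?_) hη
    rw [memLp_two_iff_integrable_sq (by fun_prop)]
    refine hint.mono (by fun_prop) (Eventually.of_forall fun y => ?_)
    rw [norm_pow, norm_pow, norm_norm]
    exact pow_le_pow_left₀ (norm_nonneg _) (PiLp.norm_apply_le y i) 2

end Concentration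

/-! ### Identification of the recurrent translations by parity, and the attractor. -/

section Attractor

variable {r : ℕ} {μ : Measure (EuclideanSpace ℝ (Fin r))}

/-- The coordinates of `v` that are lattice coordinates of `μ` are integers. -/
def LatticeIntegral (μ : Measure (EuclideanSpace ℝ (Fin r))) (v : EuclideanSpace ℝ (Fin r)) :
    Prop :=
  ∀ i, IsLattice (marginal μ i) → ∃ k : ℤ, v i = k

lemma LatticeIntegral.add {v w : EuclideanSpace ℝ (Fin r)} (hv : LatticeIntegral μ v)
    (hw : LatticeIntegral μ w) : LatticeIntegral μ (v + w) := fun i hi => by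
  obtain ⟨a, ha⟩ := hv i hi
  obtain ⟨b, hb⟩ := hw i hi
  exact ⟨a + b, by simp [ha, hb]⟩

lemma LatticeIntegral.neg {v : EuclideanSpace ℝ (Fin r)} (hv : LatticeIntegral μ v) :
    LatticeIntegral μ (-v) := fun i hi => by
  obtain ⟨a, ha⟩ := hv i hi
  exact ⟨-a, by simp [ha]⟩

lemma parity_add {v w : EuclideanSpace ℝ (Fin r)} (hv : LatticeIntegral μ v)
    (hw : LatticeIntegral μ w) : parity μ (v + w) = parity μ v + parity μ w := by
  funext i
  by_cases hi : IsLattice (marginal μ i)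
  · obtain ⟨a, ha⟩ := hv i hi
    obtain ⟨b, hb⟩ := hw i hi
    have : (a : ℝ) + b = ((a + b : ℤ) : ℝ) := by push_cast; rfl
    simp only [parity, hi, if_true, PiLp.add_apply, ha, hb, Pi.add_apply, Int.floor_intCast, this]
    push_cast
    rfl
  · simp [parity, hi]

lemma parity_zero : parity μ (0 : EuclideanSpace ℝ (Fin r)) = 0 := by
  funext i
  simp [parity]

lemma parity_neg {v : EuclideanSpace ℝ (Fin r)} (hv : LatticeIntegral μ v) :
    parity μ (-v) = -parity μ v := by
  have := parity_add hv hv.neg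
  rw [add_neg_cancel, parity_zero] at this
  exact (neg_eq_of_add_eq_zero_right this.symm).symm

lemma parity_sub {v w : EuclideanSpace ℝ (Fin r)} (hv : LatticeIntegral μ v)
    (hw : LatticeIntegral μ w) : parity μ (v - w) = parity μ v - parity μ w := by
  rw [sub_eq_add_neg, parity_add hv hw.neg, parity_neg hw, ← sub_eq_add_neg]

lemma latticeIntegral_of_mem_stateSpace {x : EuclideanSpace ℝ (Fin r)} (hx : x ∈ stateSpace μ) :
    LatticeIntegral μ x := fun i hi => by
  obtain ⟨k, hk⟩ := (hx i).2 hi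
  exact ⟨k, by simpa using hk⟩

lemma ae_latticeIntegral
    (hlat : ∀ i, IsLattice (marginal μ i) → IsNormalizedLattice (marginal μ i)) :
    ∀ᵐ y ∂μ, LatticeIntegral μ y := by
  refine ae_all_iff.2 fun i => ?_
  have h1 : ∀ᵐ a ∂(marginal μ i), a ∈ (marginal μ i).support := Measure.support_mem_ae
  filter_upwards [ae_of_ae_map (by fun_prop) h1] with y hy hi
  exact (hlat i hi).1 _ hy

lemma continuous_flipCoord (i : Fin r) : Continuous (flipCoord i) := by
  unfold flipCoord
  refine (PiLp.continuous_toLp 2 _).comp (continuous_pi fun j => ?_)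
  split_ifs <;> fun_prop

variable [IsProbabilityMeasure μ]

/-- The numbers `a` such that translation by `2 * a` along the `i`-th axis preserves the set of
recurrent points. -/
noncomputable def axisGroup (μ : Measure (EuclideanSpace ℝ (Fin r))) (i : Fin r) : AddSubgroup ℝ :=
  (recurrenceGroup μ).comap
    (AddMonoidHom.mk' (fun a : ℝ => EuclideanSpace.single i (2 * a)) fun a b => by
      ext j
      by_cases hj : j = i <;> simp [hj, mul_add])

omit [IsProbabilityMeasure μ] in
lemma mem_axisGroup {i : Fin r} {a : ℝ} :
    a ∈ axisGroup μ i ↔ EuclideanSpace.single i (2 * a) ∈ recurrenceGroup μ := Iff.rfl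

omit [IsProbabilityMeasure μ] in
lemma isClosed_axisGroup (i : Fin r) : IsClosed (axisGroup μ i : Set ℝ) := by
  have hc : Continuous fun a : ℝ => (EuclideanSpace.single i (2 * a) : EuclideanSpace ℝ (Fin r)) := by
    have : (fun a : ℝ => (EuclideanSpace.single i (2 * a) : EuclideanSpace ℝ (Fin r)))
        = fun a : ℝ => (2 * a) • EuclideanSpace.single i (1 : ℝ) := by
      funext a
      ext j
      by_cases hj : j = i <;> simp [hj]
    rw [this]
    fun_prop
  exact (isClosed_recurrenceGroup μ).preimage hc

/-- A support point minus its flip is `2 * y i` along axis `i`, which explains the factor `2` in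
`axisGroup`. Closedness extends this from almost every `y i` to the support of the marginal. -/
lemma support_marginal_subset_axisGroup (h : FullySymmetric μ) (i : Fin r) :
    (marginal μ i).support ⊆ axisGroup μ i := by
  refine Measure.support_subset_of_isClosed (isClosed_axisGroup i) ?_
  rw [marginal, mem_ae_map_iff (by fun_prop) (isClosed_axisGroup i).measurableSet]
  filter_upwards [Measure.support_mem_ae (μ := μ)] with y hy
  have h1 := support_subset_recurrenceGroup h.map_neg hy
  have h2 := support_subset_recurrenceGroup h.map_neg
    (mem_support_of_map_eq (continuous_flipCoord i) (h i) hy)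
  have e : EuclideanSpace.single i (2 * y i) = y - flipCoord i y := by
    ext j
    by_cases hj : j = i
    · subst hj
      simp [flipCoord, two_mul]
    · simp [flipCoord, hj]
  change EuclideanSpace.single i (2 * y i) ∈ recurrenceGroup μ
  rw [e]
  exact sub_mem h1 h2

lemma intCast_mem_axisGroup (h : FullySymmetric μ) {i : Fin r}
    (hi : IsNormalizedLattice (marginal μ i)) (k : ℤ) : (k : ℝ) ∈ axisGroup μ i := by
  obtain ⟨d, hd⟩ := Int.subgroup_cyclic ((axisGroup μ i).comap (Int.castAddHom ℝ))
  have hmem (k : ℤ) : (k : ℝ) ∈ axisGroup μ i ↔ d ∣ k := by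
    have : k ∈ (axisGroup μ i).comap (Int.castAddHom ℝ) ↔ (k : ℝ) ∈ axisGroup μ i := Iff.rfl
    rw [← this, hd, ← AddSubgroup.zmultiples_eq_closure, Int.mem_zmultiples_iff]
  have h1 : d.natAbs = 1 := hi.2 _ fun k hk => by
    rw [Int.natAbs_dvd]
    exact (hmem k).1 (support_marginal_subset_axisGroup h i hk)
  rw [hmem]
  exact (Int.isUnit_iff_natAbs_eq.2 h1).dvd

/-- A closed subgroup of `ℝ` is everything or cyclic; a cyclic one containing the support would make
the marginal lattice. -/
lemma axisGroup_eq_top (h : FullySymmetric μ) {i : Fin r} (hi : ¬ IsLattice (marginal μ i)) :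
    axisGroup μ i = ⊤ := by
  rcases (axisGroup μ i).dense_or_cyclic with hd | ⟨a, ha⟩
  · exact SetLike.coe_injective ((isClosed_axisGroup i).closure_eq.symm.trans hd.closure_eq)
  · refine absurd ?_ hi
    have hs (y : ℝ) (hy : y ∈ (marginal μ i).support) : ∃ n : ℤ, n • a = y := by
      have := support_marginal_subset_axisGroup h i hy
      rw [ha] at this
      exact AddSubgroup.mem_closure_singleton.1 this
    rcases eq_or_ne a 0 with rfl | ha0
    · exact ⟨1, one_pos, fun y hy => ⟨0, by obtain ⟨n, hn⟩ := hs y hy; simpa using hn.symm⟩⟩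
    · refine ⟨|a|, abs_pos.2 ha0, fun y hy => ?_⟩
      obtain ⟨n, rfl⟩ := hs y hy
      rcases abs_choice a with h1 | h1
      · exact ⟨n, by rw [h1, zsmul_eq_mul, mul_comm]⟩
      · exact ⟨-n, by rw [h1, zsmul_eq_mul]; push_cast; ring⟩

lemma mem_recurrenceGroup_of_parity_eq_zero (h : FullySymmetric μ)
    (hlat : ∀ i, IsLattice (marginal μ i) → IsNormalizedLattice (marginal μ i))
    {v : EuclideanSpace ℝ (Fin r)} (hv : LatticeIntegral μ v) (hp : parity μ v = 0) :
    v ∈ recurrenceGroup μ := by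
  have e : v = ∑ i, EuclideanSpace.single i (v i) := by
    ext j
    simp [Pi.single_apply]
  rw [e]
  refine sum_mem fun i _ => ?_
  have e2 : v i = 2 * (v i / 2) := by ring
  rw [e2, ← mem_axisGroup]
  by_cases hi : IsLattice (marginal μ i)
  · obtain ⟨k, hk⟩ := hv i hi
    have h1 := congrFun hp i
    simp only [parity, hi, if_true, hk, Int.floor_intCast, Pi.zero_apply] at h1
    obtain ⟨m, rfl⟩ := (ZMod.intCast_zmod_eq_zero_iff_dvd k 2).1 h1
    have : v i / 2 = (m : ℝ) := by rw [hk]; push_cast; ring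
    rw [this]
    exact intCast_mem_axisGroup h (hlat i hi) m
  · rw [axisGroup_eq_top h hi]
    trivial

/-- Each generator of `parityGroup μ` is the parity of an integral support point, so each element
lifts to the recurrence group; subtracting the lift leaves parity `0`. -/
lemma mem_recurrenceGroup_of_parity_mem (h : FullySymmetric μ)
    (hlat : ∀ i, IsLattice (marginal μ i) → IsNormalizedLattice (marginal μ i))
    {v : EuclideanSpace ℝ (Fin r)} (hv : LatticeIntegral μ v)
    (hp : parity μ v ∈ parityGroup μ) : v ∈ recurrenceGroup μ := by
  have key (ε : Fin r → ZMod 2) (hε : ε ∈ parityGroup μ) :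
      ∃ w ∈ recurrenceGroup μ, LatticeIntegral μ w ∧ parity μ w = ε := by
    unfold parityGroup at hε
    induction hε using AddSubgroup.closure_induction with
    | mem ε hε =>
      have hae : ∀ᵐ y ∂μ, y ∈ μ.support ∧ LatticeIntegral μ y :=
        (Filter.Eventually.and Measure.support_mem_ae (ae_latticeIntegral hlat))
      obtain ⟨y, hy1, hy2, hy3⟩ : ∃ y, parity μ y = ε ∧ y ∈ μ.support ∧ LatticeIntegral μ y := by
        by_contra! hcon
        refine (show 0 < μ {y | parity μ y = ε} from hε).ne' (measure_mono_null ?_ hae)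
        exact fun y hy hcon' => hcon y hy hcon'.1 hcon'.2
      exact ⟨y, support_subset_recurrenceGroup h.map_neg hy2, hy3, hy1⟩
    | zero => exact ⟨0, zero_mem _, fun i _ => ⟨0, by simp⟩, parity_zero⟩
    | add a b _ _ ha hb =>
      obtain ⟨u, hu1, hu2, rfl⟩ := ha
      obtain ⟨w, hw1, hw2, rfl⟩ := hb
      exact ⟨u + w, add_mem hu1 hw1, hu2.add hw2, parity_add hu2 hw2⟩
    | neg a _ ha =>
      obtain ⟨u, hu1, hu2, rfl⟩ := ha
      exact ⟨-u, neg_mem hu1, hu2.neg, parity_neg hu2⟩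
  obtain ⟨w, hw1, hw2, hw3⟩ := key _ hp
  have h1 : v - w ∈ recurrenceGroup μ := by
    refine mem_recurrenceGroup_of_parity_eq_zero h hlat ?_ ?_
    · rw [sub_eq_add_neg]
      exact hv.add hw2.neg
    · rw [parity_sub hv hw2, hw3, sub_self]
  simpa using add_mem h1 hw1

omit [IsProbabilityMeasure μ] in
lemma isClosed_stateSpace (μ : Measure (EuclideanSpace ℝ (Fin r))) : IsClosed (stateSpace μ) := by
  have : stateSpace μ = ⋂ i, {x | 0 ≤ x i} ∩ ⋂ _ : IsLattice (marginal μ i),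
      (fun x : EuclideanSpace ℝ (Fin r) => x i) ⁻¹' Set.range ((↑) : ℕ → ℝ) := by
    ext x
    simp [stateSpace, eq_comm]
  rw [this]
  refine isClosed_iInter fun i => (isClosed_le continuous_const (by fun_prop)).inter
    (isClosed_iInter fun _ => ?_)
  exact Nat.isClosedEmbedding_coe_real.isClosed_range.preimage (by fun_prop)

omit [IsProbabilityMeasure μ] in
lemma parity_eq_of_dist_lt_one {x y : EuclideanSpace ℝ (Fin r)} (hx : LatticeIntegral μ x)
    (hy : LatticeIntegral μ y) (hxy : dist x y < 1) : parity μ x = parity μ y := by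
  funext i
  by_cases hi : IsLattice (marginal μ i)
  · obtain ⟨a, ha⟩ := hx i hi
    obtain ⟨b, hb⟩ := hy i hi
    have h1 : |x i - y i| < 1 := by
      refine lt_of_le_of_lt ?_ hxy
      rw [dist_eq_norm]
      exact PiLp.norm_apply_le (x - y) i
    rw [ha, hb] at h1
    have h2 : |a - b| < 1 := (Int.cast_lt (R := ℝ)).1 (by push_cast; exact h1)
    have h3 : a = b := sub_eq_zero.1 (Int.abs_lt_one_iff.1 h2)
    simp only [parity, ha, hb, h3]
  · simp [parity, hi]

omit [IsProbabilityMeasure μ] in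
lemma isClosed_parityClass (μ : Measure (EuclideanSpace ℝ (Fin r)))
    (x₀ : EuclideanSpace ℝ (Fin r)) : IsClosed (parityClass μ x₀) := by
  refine isClosed_of_closure_subset fun x hx => ?_
  have hxs : x ∈ stateSpace μ :=
    (isClosed_stateSpace μ).closure_subset_iff.2 (fun y hy => hy.1) hx
  obtain ⟨y, hy, hxy⟩ := Metric.mem_closure_iff.1 hx 1 one_pos
  refine ⟨hxs, ?_⟩
  -- Lattice coordinates are integers, so they agree for points at distance below `1`, and the coset
  -- passes to limits.
  rw [parity_eq_of_dist_lt_one (latticeIntegral_of_mem_stateSpace hxs)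
    (latticeIntegral_of_mem_stateSpace hy.1) hxy]
  exact hy.2

lemma dist_coordAbs_le (x y : EuclideanSpace ℝ (Fin r)) :
    dist (coordAbs x) (coordAbs y) ≤ dist x y := by
  rw [EuclideanSpace.dist_eq, EuclideanSpace.dist_eq]
  refine Real.sqrt_le_sqrt (Finset.sum_le_sum fun i _ => ?_)
  exact pow_le_pow_left₀ dist_nonneg (abs_abs_sub_abs_le_abs_sub (x i) (y i)) 2

theorem FullySymmetric.isRecurrentWithAttractor_rrw (h : FullySymmetric μ)
    (hlat : ∀ i, IsLattice (marginal μ i) → IsNormalizedLattice (marginal μ i))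
    (hr : r = 1 ∨ r = 2) (hint : Integrable (fun y => ‖y‖ ^ r) μ)
    {Ω : Type*} [MeasurableSpace Ω]
    {P : Measure Ω} {Y : ℕ → Ω → EuclideanSpace ℝ (Fin r)}
    (hlaw : ∀ n, HasLaw (Y n) μ P) (hindep : iIndepFun Y P)
    {x₀ : EuclideanSpace ℝ (Fin r)} (hx₀ : x₀ ∈ stateSpace μ) :
    IsRecurrentWithAttractor P (parityClass μ x₀) (rrw Y) (parityClass μ x₀) := by
  have h0 := zero_mem_recurrentPoints_of_dim_le_two h.map_neg hr hint
  refine ⟨⟨⟨x₀, hx₀, ?_⟩, isClosed_parityClass μ x₀, subset_rfl, ?_⟩, fun L hL => hL.2.2.1⟩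
  · rw [sub_self]
    exact zero_mem _
  rintro U hU ⟨x', hx'U, hx'⟩ x hx
  have hi := latticeIntegral_of_mem_stateSpace hx.1
  have hi' := latticeIntegral_of_mem_stateSpace hx'.1
  -- When the walk `S` is near `x - x'`, the unfolded position `x - S` is near `x'`; `coordAbs` does
  -- not increase distances and fixes `x'`.
  have hmem : x - x' ∈ recurrentPoints μ := by
    refine recurrenceGroup_subset h0 (mem_recurrenceGroup_of_parity_mem h hlat ?_ ?_)
    · rw [sub_eq_add_neg]
      exact hi.add hi'.neg
    · rw [parity_sub hi hi', ← sub_sub_sub_cancel_right _ _ (parity μ x₀)]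
      exact sub_mem hx.2 hx'.2
  obtain ⟨δ, hδ, hball⟩ := Metric.isOpen_iff.1 hU x' hx'U
  refine h.ae_rrw hlaw hindep (fun i => (hx.1 i).1) (Q := fun X => ∃ᶠ n in atTop, X n ∈ U) ?_
  have hae (k : ℕ) : ∀ᵐ z ∂(iid μ), ¬ ∀ m ≥ k, δ ≤ ‖partialSum m z - (x - x')‖ := by
    rw [ae_iff]
    simpa only [not_not] using hmem δ hδ k
  filter_upwards [ae_all_iff.2 hae] with z hz
  refine frequently_atTop.2 fun k => ?_
  have hzk := hz k
  push Not at hzk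
  obtain ⟨m, hm, hlt⟩ := hzk
  refine ⟨m, hm, hball ?_⟩
  have e : coordAbs x' = x' := by
    ext i
    simp [coordAbs, abs_of_nonneg (hx'.1 i).1]
  rw [Metric.mem_ball, ← e]
  refine (dist_coordAbs_le _ _).trans_lt ?_
  have e2 : -(x - partialSum m z - x') = partialSum m z - (x - x') := by abel
  rwa [dist_eq_norm, ← norm_neg, e2]

end Attractor

end ReflectedRW

theorem mainTheorem5 {r : ℕ} (μ : Measure (EuclideanSpace ℝ (Fin r))) [IsProbabilityMeasure μ]
    (hlat : ∀ i, ReflectedRW.IsLattice (ReflectedRW.marginal μ i) →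
      ReflectedRW.IsNormalizedLattice (ReflectedRW.marginal μ i))
    (hsymm : ReflectedRW.FullySymmetric μ)
    {Ω : Type*} [MeasurableSpace Ω] (P : Measure Ω) [IsProbabilityMeasure P]
    (Y : ℕ → Ω → EuclideanSpace ℝ (Fin r))
    (hlaw : ∀ n, HasLaw (Y n) μ P) (hindep : iIndepFun Y P) :
    (3 ≤ r → ReflectedRW.IsTransient P (ReflectedRW.stateSpace μ) (ReflectedRW.rrw Y)) ∧
    ((r = 1 ∨ r = 2) → Integrable (fun y => ‖y‖ ^ r) μ →
      ∀ x₀ ∈ ReflectedRW.stateSpace μ,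
        ReflectedRW.IsRecurrentWithAttractor P (ReflectedRW.parityClass μ x₀)
          (ReflectedRW.rrw Y) (ReflectedRW.parityClass μ x₀)) := by
  exact ⟨fun hr => hsymm.isTransient_rrw (ReflectedRW.measure_coord_ne_zero_pos hlat) hr hlaw hindep,
    fun hr hint _ hx₀ => hsymm.isRecurrentWithAttractor_rrw hlat hr hint hlaw hindep hx₀⟩
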